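/- Setting. Let $M$ be an $n$-dimensional smooth Riemannian manifold without boundary and $\mathcal S$ a smooth complex vector bundle of rank $N$ over $M$ with a smooth connection $\nabla$. Near a point $x'$ the connection is split, in a chart and a trivialization, as $\nabla_a=\partial_a+\omega_a+i\,a_a$ into a $G$-connection form $\omega$ (endomorphism valued) and a real $U(1)$ potential $a$, whose curvature $F_{ab}=\partial_aa_b-\partial_ba_a$ is parallel, $\nabla_cF_{ab}=0$. Let $u=(u^\mu)$ be normal coordinates centred at $x'$ with respect to an orthonormal frame, $\eta^\mu{}_a=\partial u^\mu/\partial x^a$, $X^{\mu\nu}=\eta^\mu{}_a g^{ab}\eta^\nu{}_b$, $\Delta=g^{-1/2}|\det\eta|$ the Van Vleck–Morette determinant, $\zeta=\frac12\log\Delta$, $\zeta_\mu=\partial_\mu\zeta$, and $\mathcal P$ the parallel transport along the geodesics from $x'$. Put $\bar\nabla_\mu=\gamma^a{}_\mu\nabla_a$ with $\gamma=\eta^{-1}$; on quantities parallel transported to $x'$ this is $\partial/\partial u^\mu$. Let $F_{\mu\nu}$ be the components of $F$ at $x'$ and $$\mathcal P^{-1}\bar\nabla_\mu\mathcal P=-\tfrac12iF_{\mu\alpha}u^\alpha+\bar{\mathscr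 A}_\mu,\qquad \mathcal D_\mu=\partial_\mu-\tfrac12iF_{\mu\alpha}u^\alpha,\qquad \mathcal D^2=\sum_\mu\mathcal D_\mu\mathcal D_\mu .$$ Since $\mathcal P$ is the product of the $G$- and the $U(1)$-transport, $\bar{\mathscr A}_\mu$ is the sum of a term of degree $0$ in $F$ (from the $G$-connection) and one of degree $1$ in $F$ (from the $U(1)$-connection). Put $$Y^\nu=\partial_\mu X^{\mu\nu}+2X^{\mu\nu}\bar{\mathscr A}_\mu,$$ $$Z=\bar{\mathscr A}_\mu X^{\mu\nu}\bar{\mathscr A}_\nu-\zeta_\mu X^{\mu\nu}\zeta_\nu+(\partial_\mu X^{\mu\nu})(\bar{\mathscr A}_\nu+\zeta_\nu)+X^{\mu\nu}\partial_\mu(\bar{\mathscr A}_\nu+\zeta_\nu).$$ Taylor expand $X,Y,Z$ at $u=0$ and count orders by $u\sim\varepsilon$, $F\sim\varepsilon^{-2}$. Let $X_k,Y_k,Z_k$ be the parts of order $\varepsilon^k,\varepsilon^{k-1},\varepsilon^{k-2}$ (so a term of degree $d$ in $u$ and $m$ in $F$ has order $\varepsilon^{d-2m}$), and let $$\mathscr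 L_k=X_k^{\mu\nu}\mathcal D_\mu\mathcal D_\nu+Y_k^\mu\mathcal D_\mu+Z_k,\qquad V_k(s)=e^{s\mathcal D^2}\mathscr L_ke^{-s\mathcal D^2}=\sum_{m\ge0}\frac{s^m}{m!}\,\mathrm{Ad}_{\mathcal D^2}^m\mathscr L_k ,$$ $$T_k(t)=\sum_{j_1+\dots+j_m=k,\ j_i\ge1}\ \int_{0\le s_1\le\dots\le s_m\le t}V_{j_1}(s_1)\cdots V_{j_m}(s_m)\,ds_1\cdots ds_m ,$$ $$U_0(t,u)=(4\pi t)^{-n/2}\det\Big(\frac{tiF}{\sinh(tiF)}\Big)^{1/2}\exp\Big(-\tfrac14u^\mu\big[iF\coth(tiF)\big]_{\mu\nu}u^\nu\Big),$$ $$b_k(t,u)=t^{-k/2}\,U_0(t,u)^{-1}\,\big(T_k(t)U_0(t,\cdot)\big)(u)\qquad(t>0).$$ Lemma. $U_0$ satisfies $\partial_tU_0=\mathcal D^2U_0$ for $t>0$ and $U_0(t,\cdot)\to\delta$ as $t\to0^+$ (tested against continuous functions with compact support), so that $U_0=e^{t\mathcal D^2}\delta(u)$. On smooth functions the series for $V_k(s)$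 converge pointwise and the integrals that define $T_k(t)$ exist. For all $k\ge0$ and $t>0$ the coefficient $b_{2k+1}(t,\cdot)$ is an odd polynomial in $u$ with values in the endomorphisms of the fibre (all its monomials have odd degree), $$b_{2k+1}(t,-u)=-b_{2k+1}(t,u)\quad\text{for all }u,$$ and therefore vanishes on the diagonal: $b^{\mathrm{diag}}_{2k+1}(t)=b_{2k+1}(t,0)=0$. -/

import Mathlib

open Bundle Set Filter Topology MeasureTheory
open scoped Manifold ContDiff

noncomputable section

namespace HeatCoeff

/-- The coordinate space `ℝⁿ`. -/
abbrev Coord (n : ℕ) : Type := EuclideanSpace ℝ (Fin n)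

/-- The typical fibre `ℂᴺ`. -/
abbrev Fib (N : ℕ) : Type := EuclideanSpace ℂ (Fin N)

/-- Endomorphisms of the typical fibre. -/
abbrev EndF (N : ℕ) : Type := Fib N →L[ℂ] Fib N

/-- The `i`-th standard basis vector of `ℝⁿ`. -/
def basisVec {n : ℕ} (i : Fin n) : Coord n := EuclideanSpace.single i 1

/-- Partial derivative `∂ f / ∂ uⁱ`. -/
def pd {n : ℕ} {A : Type*} [NormedAddCommGroup A] [NormedSpace ℝ A]
    (i : Fin n) (f : Coord n → A) (u : Coord n) : A :=
  fderiv ℝ f u (basisVec i)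

/-! ### Local expressions of a metric and of a `G × U(1)` connection -/

/-- Components in a coordinate patch and a local trivialization: the metric `g_{ab}`, the
`G`-connection form `ω_a` and the `U(1)` potential `a_a`.
The total connection is `∇_a = ∂_a + ω_a + i a_a`. -/
structure LocalData (n N : ℕ) where
  metric : Coord n → Matrix (Fin n) (Fin n) ℝ
  gForm : Fin n → Coord n → EndF N
  pot : Fin n → Coord n → ℝ

namespace LocalData

variable {n N : ℕ} (D : LocalData n N)

/-- Christoffel symbols `Γ^c_{ab}` of the Levi-Civita connection. -/
def christoffel (c a b : Fin n) (y : Coord n) : ℝ :=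
  (1 / 2) * ∑ d, (D.metric y)⁻¹ c d *
    (pd a (fun z => D.metric z d b) y + pd b (fun z => D.metric z d a) y
      - pd d (fun z => D.metric z a b) y)

/-- `U(1)` curvature `F_{ab} = ∂_a a_b - ∂_b a_a`. -/
def curvF (a b : Fin n) (y : Coord n) : ℝ := pd a (D.pot b) y - pd b (D.pot a) y

/-- The `U(1)` curvature is parallel: `∇_c F_{ab} = 0`. -/
def ParallelF (s : Set (Coord n)) : Prop :=
  ∀ y ∈ s, ∀ c a b : Fin n,
    pd c (D.curvF a b) y - ∑ d, D.christoffel d c a y * D.curvF d b y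
      - ∑ d, D.christoffel d c b y * D.curvF a d y = 0

/-- `c` satisfies the geodesic equation at the parameter `s`. -/
def GeodesicAt (c : ℝ → Coord n) (s : ℝ) : Prop :=
  ∀ a : Fin n, (deriv (deriv c) s) a
    + ∑ b, ∑ d, D.christoffel a b d (c s) * (deriv c s) b * (deriv c s) d = 0

/-- `ψ`, defined on the ball of radius `r`, is a normal coordinate system centred at the point with
coordinates `y₀`: it sends `u` to the point with normal coordinates `u` with respect to the frame
`∂ψ/∂u^μ (0)`, which is orthonormal. -/
structure IsNormalCoord (y₀ : Coord n) (r : ℝ) (ψ : Coord n → Coord n) : Prop where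
  smooth : ContDiffOn ℝ ∞ ψ (Metric.ball 0 r)
  center : ψ 0 = y₀
  orthonormal : ∀ μ ν : Fin n,
    ∑ a, ∑ b, D.metric y₀ a b * (pd μ ψ 0) a * (pd ν ψ 0) b = if μ = ν then 1 else 0
  geodesic : ∀ u ∈ Metric.ball (0 : Coord n) r, ∀ s ∈ Icc (0 : ℝ) 1,
    D.GeodesicAt (fun τ => ψ (τ • u)) s

/-- `P u` is the parallel transport of the `G`-connection along the geodesic `s ↦ ψ (s u)` from the
centre to `ψ u`. -/
structure IsTransportG (ψ : Coord n → Coord n) (r : ℝ) (P : Coord n → EndF N) : Prop where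
  smooth : ContDiffOn ℝ ∞ P (Metric.ball 0 r)
  init : P 0 = 1
  transport : ∀ u ∈ Metric.ball (0 : Coord n) r, ∀ s ∈ Icc (0 : ℝ) 1,
    HasDerivAt (fun τ : ℝ => P (τ • u))
      (-∑ a, (deriv (fun τ : ℝ => ψ (τ • u)) s) a • (D.gForm a (ψ (s • u)) * P (s • u))) s

/-- `p u` is the parallel transport of the `U(1)`-connection along the same geodesics. The parallel
transport of the total connection is the product `p u • P u`. -/
structure IsTransportU (ψ : Coord n → Coord n) (r : ℝ) (p : Coord n → ℂ) : Prop where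
  smooth : ContDiffOn ℝ ∞ p (Metric.ball 0 r)
  init : p 0 = 1
  transport : ∀ u ∈ Metric.ball (0 : Coord n) r, ∀ s ∈ Icc (0 : ℝ) 1,
    HasDerivAt (fun τ : ℝ => p (τ • u))
      (-∑ a, (((deriv (fun τ : ℝ => ψ (τ • u)) s) a : ℝ) : ℂ)
        * (Complex.I * (D.pot a (ψ (s • u)) : ℂ)) * p (s • u)) s

end LocalData

/-- A local geometry together with normal coordinates `ψ` and the parallel transports. -/
structure NormalData (n N : ℕ) extends LocalData n N where
  ψ : Coord n → Coord n
  P : Coord n → EndF N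
  p : Coord n → ℂ

namespace NormalData

variable {n N : ℕ} (D : NormalData n N)

/-- `γ^a_μ = ∂x^a/∂u^μ`. -/
def gam (u : Coord n) : Matrix (Fin n) (Fin n) ℝ := fun a μ => (pd μ D.ψ u) a

/-- `η^μ_a = ∂u^μ/∂x^a`, the inverse of `γ`. -/
def eta (u : Coord n) : Matrix (Fin n) (Fin n) ℝ := (D.gam u)⁻¹

/-- `X^{μν} = η^μ_a g^{ab} η^ν_b`. -/
def X (u : Coord n) : Matrix (Fin n) (Fin n) ℝ :=
  D.eta u * (D.metric (D.ψ u))⁻¹ * (D.eta u).transpose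

/-- The Van Vleck-Morette determinant `g(x)^{-1/2} |det(η)|`. (The mixed second derivative of the
world function is `∇_a ∇'_μ σ = η_{μ a}`, and the frame at the centre is orthonormal.) -/
def vanVleck (u : Coord n) : ℝ := |(D.eta u).det| / Real.sqrt (D.metric (D.ψ u)).det

/-- `ζ = (1/2) log Δ`. -/
def zeta (u : Coord n) : ℝ := (1 / 2) * Real.log (D.vanVleck u)

/-- Components `F_{μν}` of the `U(1)` curvature at the centre in the normal frame. -/
def F : Matrix (Fin n) (Fin n) ℝ := fun μ ν =>
  ∑ a, ∑ b, D.gam 0 a μ * D.gam 0 b ν * D.curvF a b (D.ψ 0)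

/-- The part of `Ā_μ` of degree zero in the `U(1)` curvature: `P⁻¹ ∇_μ P` for the
`G`-connection. -/
def AbarG (μ : Fin n) (u : Coord n) : EndF N :=
  Ring.inverse (D.P u) * (pd μ D.P u + ∑ a, D.gam u a μ • (D.gForm a (D.ψ u) * D.P u))

/-- The part of `Ā_μ` of degree one in the `U(1)` curvature: `p⁻¹ ∇_μ p + (i/2) F_{μα} u^α`. The
total quantity is `A_μ = -(i/2) F_{μα} u^α + Ā_μ` with `Ā_μ = AbarG + AbarU`. -/
def AbarU (μ : Fin n) (u : Coord n) : ℂ :=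
  (D.p u)⁻¹ * (pd μ D.p u
      + ∑ a, (D.gam u a μ : ℂ) * (Complex.I * (D.pot a (D.ψ u) : ℂ)) * D.p u)
    + (1 / 2) * Complex.I * ∑ α, (D.F μ α : ℂ) * (u α : ℂ)

/-- `Y^ν = ∂_μ X^{μν} + 2 X^{μν} Ā_μ`: the part of degree `0` in the `U(1)` curvature. -/
def Y0 (ν : Fin n) (u : Coord n) : EndF N :=
  ∑ μ, (pd μ (fun v => D.X v μ ν) u • (1 : EndF N) + (2 * D.X u μ ν) • D.AbarG μ u)

/-- The part of `Y^ν` of degree `1` in the `U(1)` curvature. -/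
def Y1 (ν : Fin n) (u : Coord n) : EndF N :=
  ∑ μ, (2 * D.X u μ ν) • D.AbarU μ u • (1 : EndF N)

/-- The part of degree `0` in the `U(1)` curvature of
`Z = Ā_μ X^{μν} Ā_ν - ζ_μ X^{μν} ζ_ν + (∂_μ X^{μν}) Ā_ν + (∂_μ X^{μν}) ζ_ν
  + X^{μν} ∂_μ Ā_ν + X^{μν} ∂_μ ζ_ν`, where `ζ_μ = ∂_μ ζ`. -/
def Z0 (u : Coord n) : EndF N :=
  ∑ μ, ∑ ν,
    (D.X u μ ν • (D.AbarG μ u * D.AbarG ν u)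
      - (D.X u μ ν * pd μ D.zeta u * pd ν D.zeta u) • (1 : EndF N)
      + pd μ (fun v => D.X v μ ν) u • D.AbarG ν u
      + (pd μ (fun v => D.X v μ ν) u * pd ν D.zeta u) • (1 : EndF N)
      + D.X u μ ν • pd μ (D.AbarG ν) u
      + (D.X u μ ν * pd μ (pd ν D.zeta) u) • (1 : EndF N))

/-- The part of `Z` of degree `1` in the `U(1)` curvature. -/
def Z1 (u : Coord n) : EndF N :=
  ∑ μ, ∑ ν,
    (D.X u μ ν • (D.AbarU μ u • D.AbarG ν u + D.AbarU ν u • D.AbarG μ u)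
      + pd μ (fun v => D.X v μ ν) u • D.AbarU ν u • (1 : EndF N)
      + D.X u μ ν • pd μ (D.AbarU ν) u • (1 : EndF N))

/-- The part of `Z` of degree `2` in the `U(1)` curvature. -/
def Z2 (u : Coord n) : EndF N :=
  ∑ μ, ∑ ν, D.X u μ ν • (D.AbarU μ u * D.AbarU ν u) • (1 : EndF N)

end NormalData

/-! ### The perturbation expansion -/

/-- The homogeneous component of degree `j` of the Taylor expansion of `f` at `0`, as a function
of `u`; it is zero for negative `j`. -/
def hom {n : ℕ} {A : Type*} [NormedAddCommGroup A] [NormedSpace ℝ A]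
    (f : Coord n → A) : ℤ → Coord n → A
  | Int.ofNat j, u => ((j.factorial : ℝ)⁻¹) • iteratedFDeriv ℝ j f 0 (fun _ => u)
  | Int.negSucc _, _ => 0

/-- The operator `𝓓_μ = ∂_μ - (i/2) F_{μα} u^α`. -/
def covD {n : ℕ} {A : Type*} [NormedAddCommGroup A] [NormedSpace ℂ A]
    (F : Matrix (Fin n) (Fin n) ℝ) (μ : Fin n) (f : Coord n → A) (u : Coord n) : A :=
  pd μ f u - ((1 / 2) * Complex.I * ∑ α, (F μ α : ℂ) * (u α : ℂ)) • f u

/-- The operator `𝓓² = δ^{μν} 𝓓_μ 𝓓_ν`. -/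
def covDsq {n : ℕ} {A : Type*} [NormedAddCommGroup A] [NormedSpace ℂ A]
    (F : Matrix (Fin n) (Fin n) ℝ) (f : Coord n → A) (u : Coord n) : A :=
  ∑ μ, covD F μ (covD F μ f) u

/-- Operators acting on endomorphism valued functions of the normal coordinates. -/
abbrev Op (n N : ℕ) : Type := (Coord n → EndF N) → (Coord n → EndF N)

/-- `Ad_{𝓓²} Q = [𝓓², Q]`. -/
def adDsq {n N : ℕ} (F : Matrix (Fin n) (Fin n) ℝ) (Q : Op n N) : Op n N :=
  fun f u => covDsq F (Q f) u - Q (covDsq F f) u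

/-- The term of index `m` of the series for `exp(s 𝓓²) Q exp(-s 𝓓²) = exp(s Ad_{𝓓²}) Q`,
applied to `f` at `u`. -/
def conjTerm {n N : ℕ} (F : Matrix (Fin n) (Fin n) ℝ) (Q : Op n N) (s : ℝ)
    (f : Coord n → EndF N) (u : Coord n) (m : ℕ) : EndF N :=
  (s ^ m / (m.factorial : ℝ)) • ((adDsq F)^[m] Q) f u

/-- `exp(s 𝓓²) Q exp(-s 𝓓²) = exp(s Ad_{𝓓²}) Q`. -/
def conjExp {n N : ℕ} (F : Matrix (Fin n) (Fin n) ℝ) (Q : Op n N) (s : ℝ) : Op n N :=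
  fun f u => ∑' m : ℕ, conjTerm F Q s f u m

/-- The ordered integral `∫_{0 ≤ s₁ ≤ ⋯ ≤ s_m ≤ t} V_{j₁}(s₁) ⋯ V_{j_m}(s_m)` for the list
`[j_m, …, j₁]`. -/
def volterra {n N : ℕ} (V : ℕ → ℝ → Op n N) : List ℕ → ℝ → Op n N
  | [], _ => fun f => f
  | j :: js, t => fun f u => ∫ s in (0 : ℝ)..t, volterra V js s (V j s f) u

/-- The entire function `cosh` of a matrix. -/
def matCosh {n : ℕ} (T : Matrix (Fin n) (Fin n) ℂ) : Matrix (Fin n) (Fin n) ℂ :=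
  ∑' m : ℕ, (((2 * m).factorial : ℂ)⁻¹) • T ^ (2 * m)

/-- The entire function `sinh(z)/z` of a matrix. -/
def matSinhc {n : ℕ} (T : Matrix (Fin n) (Fin n) ℂ) : Matrix (Fin n) (Fin n) ℂ :=
  ∑' m : ℕ, (((2 * m + 1).factorial : ℂ)⁻¹) • T ^ (2 * m)

/-- The matrix `t i F`. -/
def tiF {n : ℕ} (F : Matrix (Fin n) (Fin n) ℝ) (t : ℝ) : Matrix (Fin n) (Fin n) ℂ :=
  ((t : ℂ) * Complex.I) • F.map (fun x : ℝ => (x : ℂ))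

/-- `J(t) = det(tiF / sinh(tiF))^{1/2}`. -/
def J {n : ℕ} (F : Matrix (Fin n) (Fin n) ℝ) (t : ℝ) : ℂ :=
  ((matSinhc (tiF F t))⁻¹.det) ^ (1 / 2 : ℂ)

/-- `M(t) = iF coth(tiF)`. -/
def M {n : ℕ} (F : Matrix (Fin n) (Fin n) ℝ) (t : ℝ) : Matrix (Fin n) (Fin n) ℂ :=
  ((t : ℂ)⁻¹) • (matCosh (tiF F t) * (matSinhc (tiF F t))⁻¹)

/-- The kernel `U₀(t, u) = exp(t 𝓓²) δ(u)`:
`U₀ = (4πt)^{-n/2} J(t) exp(-(1/4) u^μ M_{μν}(t) u^ν)`. -/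
def U0 {n : ℕ} (F : Matrix (Fin n) (Fin n) ℝ) (t : ℝ) (u : Coord n) : ℂ :=
  (((4 * Real.pi * t) ^ (-(n : ℝ) / 2) : ℝ) : ℂ) * J F t
    * Complex.exp (-(1 / 4) * ∑ μ, ∑ ν, (u μ : ℂ) * M F t μ ν * (u ν : ℂ))

namespace NormalData

variable {n N : ℕ} (D : NormalData n N)

/-- `X_k^{μν}`: homogeneous of degree `k` in `u`. -/
def Xk (k : ℕ) (μ ν : Fin n) (u : Coord n) : ℝ := hom (fun v => D.X v μ ν) k u

/-- `Y_k^μ`: the part of order `ε^{k-1}`, where `u ∼ ε` and `F ∼ ε^{-2}`. -/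
def Yk (k : ℕ) (μ : Fin n) (u : Coord n) : EndF N :=
  hom (D.Y0 μ) ((k : ℤ) - 1) u + hom (D.Y1 μ) ((k : ℤ) + 1) u

/-- `Z_k`: the part of order `ε^{k-2}`, where `u ∼ ε` and `F ∼ ε^{-2}`. -/
def Zk (k : ℕ) (u : Coord n) : EndF N :=
  hom D.Z0 ((k : ℤ) - 2) u + hom D.Z1 (k : ℤ) u + hom D.Z2 ((k : ℤ) + 2) u

/-- `𝓛_k = X_k^{μν} 𝓓_μ 𝓓_ν + Y_k^μ 𝓓_μ + Z_k`. -/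
def Lk (k : ℕ) : Op n N := fun f u =>
  ∑ μ, ∑ ν, D.Xk k μ ν u • covD D.F μ (covD D.F ν f) u
    + ∑ μ, D.Yk k μ u * covD D.F μ f u + D.Zk k u * f u

/-- `V_k(s) = exp(s 𝓓²) 𝓛_k exp(-s 𝓓²)`. -/
def Vk (k : ℕ) (s : ℝ) : Op n N := conjExp D.F (D.Lk k) s

/-- `T_k(t)`: the part of order `ε^k` of the Volterra series of
`exp(t(𝓓² + ∑_{k ≥ 1} 𝓛_k)) exp(-t 𝓓²)`, the sum over all compositions `j₁ + ⋯ + j_m = k`. -/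
def Tk (k : ℕ) (t : ℝ) : Op n N := fun f u =>
  ∑ c : Composition k, volterra D.Vk c.blocks t f u

/-- `b_k(t, u) = t^{-k/2} U₀⁻¹ T_k(t) U₀`. -/
def b (k : ℕ) (t : ℝ) (u : Coord n) : EndF N :=
  (((t ^ (-(k : ℝ) / 2) : ℝ) : ℂ) * (U0 D.F t u)⁻¹) •
    D.Tk k t (fun v => U0 D.F t v • (1 : EndF N)) u

end NormalData

/-- `f` is a polynomial in the coordinates all of whose monomials have odd degree. -/
def IsOddPolynomial {n : ℕ} {A : Type*} [AddCommGroup A] [Module ℝ A] (f : Coord n → A) : Prop :=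
  ∃ c : (Fin n →₀ ℕ) →₀ A, (∀ α ∈ c.support, Odd (∑ i, α i)) ∧
    ∀ u, f u = c.sum fun α a => (∏ i, (u i) ^ (α i)) • a

/-! ### Local expressions of the objects on a manifold -/

section Manifold

variable {n N : ℕ} {X : Type*} [TopologicalSpace X] [ChartedSpace (Coord n) X]

/-- The coordinate vector field `∂_a` of the chart `φ` at the point with coordinates `y`. -/
def coordVec (φ : OpenPartialHomeomorph X (Coord n)) (y : Coord n) (a : Fin n) :
    TangentSpace (𝓡 n) (φ.symm y) :=
  mfderiv 𝓘(ℝ, Coord n) (𝓡 n) φ.symm y (basisVec a : Coord n)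

variable [IsManifold (𝓡 n) ∞ X] [RiemannianBundle (fun x : X => TangentSpace (𝓡 n) x)]
  {S : X → Type*} [TopologicalSpace (TotalSpace (Fib N) S)]
  [∀ x, AddCommGroup (S x)] [∀ x, Module ℂ (S x)] [∀ x, TopologicalSpace (S x)]
  [∀ x, IsTopologicalAddGroup (S x)] [∀ x, ContinuousSMul ℝ (S x)]
  [FiberBundle (Fib N) S]

/-- The form `B_a` of the connection `∇` in the chart `φ` and the trivialization `e`:
`∇_a = ∂_a + B_a`. -/
def connForm (φ : OpenPartialHomeomorph X (Coord n))
    (e : Trivialization (Fib N) (TotalSpace.proj : TotalSpace (Fib N) S → X))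
    (cov : CovariantDerivative (𝓡 n) (Fib N) S) (a : Fin n) (y : Coord n) : EndF N :=
  LinearMap.toContinuousLinearMap
    ((EuclideanSpace.basisFun (Fin N) ℂ).toBasis.constr ℂ fun j =>
      (e ⟨φ.symm y, cov (fun x => e.symm x (EuclideanSpace.basisFun (Fin N) ℂ j))
        (φ.symm y) (coordVec φ y a)⟩).2)

/-- The local data of the metric of `X` and of the connection `∇` on `S`, split by the `U(1)`
potential `pot` into the `U(1)` part `i a_a` and the `G`-part `ω_a = B_a - i a_a`. -/
def localData (φ : OpenPartialHomeomorph X (Coord n))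
    (e : Trivialization (Fib N) (TotalSpace.proj : TotalSpace (Fib N) S → X))
    (cov : CovariantDerivative (𝓡 n) (Fib N) S) (pot : Fin n → Coord n → ℝ) :
    LocalData n N where
  metric y := fun a b => inner ℝ (coordVec φ y a) (coordVec φ y b)
  gForm a y := connForm φ e cov a y - (Complex.I * (pot a y : ℂ)) • (1 : EndF N)
  pot := pot

end Manifold

end HeatCoeff

end

/-! The theorem is a parity count. The potential in 𝓓_μ is linear in u, so the letters u^μ and 𝓓_μ
have scalar commutators: [𝓓_i, u^j] = δ_ij and [𝓓_i, 𝓓_j] = (i/2)(F_ij - F_ji). Give each letter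
degree one modulo 2. Since F carries the even order -2, every term of 𝓛_k is a constant endomorphism
times a word whose length has the parity of k (`exists_Lk`).

The commutator with 𝓓² is a derivation that kills constant endomorphisms and sends each letter to a
combination of the 𝓓_i, so it preserves word length (`opAd_wordSpan`). Words of a given length span
a finite dimensional space, on which exp(s Ad) is the exponential of a matrix. Hence the series for
V_k(s) converges, and V_k(s) is a finite sum of fixed operators of parity k with coefficients
continuous in s (`IsAdFinite.exists_hasSum`). Products add parities and time integrals act on the
coefficients alone, so T_k(t) has parity k.

On the Gaussian U₀ each 𝓓_μ acts as multiplication by a linear function. Every letter therefore maps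
U₀ times a polynomial of parity p to U₀ times one of parity p + 1, and b_k is a polynomial of the
parity of k.

For U₀ itself, iF is Hermitian, and in an eigenbasis the kernel splits into one factor per
eigenvalue l. The function c = l coth(tl) satisfies c' = l² - c² and is the logarithmic derivative
of sinh(tl)/l; this is the heat equation. The initial condition follows by substituting u = √t v and
dominated convergence. -/

noncomputable section

namespace HeatCoeff

/-! ### Polynomials in the coordinates graded by an additive monoid -/

/-- Functions generated from constants by multiplication with coordinates, with a degree in `ι`. -/
inductive GradedPoly {n : ℕ} {A : Type*} [AddCommGroup A] [Module ℝ A] {ι : Type*}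
    [AddMonoidWithOne ι] : ι → (Coord n → A) → Prop
  | const (a : A) : GradedPoly 0 (fun _ => a)
  -- Zero is needed in every degree: for empty sums and for derivatives of constants.
  | zero (j : ι) : GradedPoly j (fun _ => 0)
  | coord (i : Fin n) {j : ι} {q : Coord n → A} (hq : GradedPoly j q) :
      GradedPoly (j + 1) (fun u => u i • q u)
  | add {j : ι} {q q' : Coord n → A} (hq : GradedPoly j q) (hq' : GradedPoly j q') :
      GradedPoly j (fun u => q u + q' u)

namespace GradedPoly

variable {n : ℕ} {A B : Type*} [AddCommGroup A] [Module ℝ A] [AddCommGroup B] [Module ℝ B]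
  {ι : Type*} [AddMonoidWithOne ι]

theorem map (L : A →ₗ[ℝ] B) {j : ι} {q : Coord n → A} (hq : GradedPoly j q) :
    GradedPoly j (fun u => L (q u)) := by
  induction hq with
  | const a => exact const (L a)
  | zero j => simpa using zero j
  | coord i hq ih => simpa using ih.coord i
  | add hq hq' ih ih' => simpa using ih.add ih'

theorem sum {κ : Type*} (s : Finset κ) {j : ι} {q : κ → Coord n → A}
    (hq : ∀ k ∈ s, GradedPoly j (q k)) : GradedPoly j (fun u => ∑ k ∈ s, q k u) := by
  classical
  induction s using Finset.induction_on with
  | empty => simpa using zero j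
  | insert a s ha ih =>
    simp only [Finset.sum_insert ha]
    exact (hq a (by simp)).add (ih fun k hk => hq k (by simp [hk]))

theorem _root_.EuclideanSpace.eq_sum_basisVec (u : Coord n) :
    u = ∑ i, u i • basisVec i := by
  have := (EuclideanSpace.basisFun (Fin n) ℝ).sum_repr u
  simpa [basisVec] using this.symm

/-- Multilinear maps give homogeneous polynomials on the diagonal. -/
theorem multilinear (j : ℕ) (T : MultilinearMap ℝ (fun _ : Fin j => Coord n) A) :
    GradedPoly j (fun u => T fun _ => u) := by
  induction j with
  | zero =>
    have : (fun u : Coord n => T fun _ => u) = fun _ => T ![] := by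
      funext u; congr 1; funext i; exact i.elim0
    rw [this]; exact const _
  | succ j ih =>
    -- Expanding only the first argument in the basis leaves a multilinear form in one variable
    -- less.
    have : (fun u : Coord n => T fun _ => u) =
        fun u => ∑ i, u i • T.curryLeft (basisVec i) (fun _ => u) := by
      funext u
      have h1 : (T fun _ => u) = T.curryLeft u (fun _ => u) := by
        rw [MultilinearMap.curryLeft_apply]
        congr 1
        funext i
        refine Fin.cases ?_ (fun i => ?_) i <;> simp
      rw [h1]
      conv_lhs => rw [EuclideanSpace.eq_sum_basisVec u]
      rw [map_sum, sum_apply]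
      refine Finset.sum_congr rfl fun i _ => ?_
      rw [map_smul, smul_apply, ← EuclideanSpace.eq_sum_basisVec u]
    rw [this]
    exact sum _ fun i _ => (ih _).coord i

/-- A Taylor component is a multiple of the diagonal of the multilinear derivative. The grading is
in any `ι`, so the same fact serves exact degree and parity. -/
theorem hom_natCast {A : Type*} [NormedAddCommGroup A] [NormedSpace ℝ A] (f : Coord n → A)
    (j : ℕ) : GradedPoly j (hom f (j : ℤ)) := by
  have := (multilinear j (iteratedFDeriv ℝ j f 0).toMultilinearMap).map
    ((j.factorial : ℝ)⁻¹ • LinearMap.id)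
  exact this

theorem contDiff {A : Type*} [NormedAddCommGroup A] [NormedSpace ℝ A] {j : ι}
    {q : Coord n → A} (hq : GradedPoly j q) : ContDiff ℝ ∞ q := by
  induction hq with
  | const a => exact contDiff_const
  | zero j => exact contDiff_const
  | coord i hq ih => exact ContDiff.smul (by fun_prop) ih
  | add hq hq' ih ih' => exact ih.add ih'

end GradedPoly

/-! ### Partial derivatives -/

section pd

variable {n : ℕ} {A : Type*} [NormedAddCommGroup A] [NormedSpace ℝ A]

theorem contDiff_pd {f : Coord n → A} (hf : ContDiff ℝ ∞ f) (i : Fin n) :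
    ContDiff ℝ ∞ (pd i f) :=
  (hf.fderiv_right (m := ∞) (by simp)).clm_apply contDiff_const

theorem pd_add {f g : Coord n → A} {u : Coord n} (hf : DifferentiableAt ℝ f u)
    (hg : DifferentiableAt ℝ g u) (i : Fin n) :
    pd i (fun v => f v + g v) u = pd i f u + pd i g u := by
  simp [pd, fderiv_fun_add hf hg]

theorem pd_smul {𝕜 : Type*} [NontriviallyNormedField 𝕜] [NormedAlgebra ℝ 𝕜] [NormedSpace 𝕜 A]
    [IsScalarTower ℝ 𝕜 A]
    {c : Coord n → 𝕜} {f : Coord n → A} {u : Coord n} (hc : DifferentiableAt ℝ c u)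
    (hf : DifferentiableAt ℝ f u) (i : Fin n) :
    pd i (fun v => c v • f v) u = c u • pd i f u + pd i c u • f u := by
  simp [pd, fderiv_fun_smul hc hf]

theorem pd_const (a : A) (i : Fin n) (u : Coord n) : pd i (fun _ : Coord n => a) u = 0 := by
  simp [pd]

theorem pd_coord (i j : Fin n) (u : Coord n) :
    pd i (fun v : Coord n => v j) u = if i = j then 1 else 0 := by
  have : (fun v : Coord n => v j) = (EuclideanSpace.proj j : Coord n →L[ℝ] ℝ) := rfl
  rw [pd, this, ContinuousLinearMap.fderiv]
  change (EuclideanSpace.single i (1 : ℝ) : Coord n) j = _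
  simp [eq_comm]

theorem pd_clm {B : Type*} [NormedAddCommGroup B] [NormedSpace ℝ B] (L : A →L[ℝ] B)
    {f : Coord n → A} {u : Coord n} (hf : DifferentiableAt ℝ f u) (i : Fin n) :
    pd i (fun v => L (f v)) u = L (pd i f u) := by
  have := (L.hasFDerivAt.comp u hf.hasFDerivAt).fderiv
  simp only [pd]
  change fderiv ℝ (L ∘ f) u _ = _
  rw [this]; rfl

theorem pd_comm {f : Coord n → A} (hf : ContDiff ℝ ∞ f) (i j : Fin n) (u : Coord n) :
    pd i (pd j f) u = pd j (pd i f) u := by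
  have hd : Differentiable ℝ (fderiv ℝ f) :=
    (hf.fderiv_right (m := ∞) (by simp)).differentiable (by simp)
  have key : ∀ i j : Fin n, pd i (pd j f) u = fderiv ℝ (fderiv ℝ f) u (basisVec i) (basisVec j) := by
    intro i j
    have := ((hd u).hasFDerivAt.clm_apply (hasFDerivAt_const (basisVec j) u)).fderiv
    simp only [pd]
    change fderiv ℝ (fun v => fderiv ℝ f v (basisVec j)) u (basisVec i) = _
    rw [this]; simp
  rw [key, key]
  exact (hf.contDiffAt.isSymmSndFDerivAt (by simpa using ENat.LEInfty.out)) _ _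

end pd

/-- Differentiation lowers the parity. -/
theorem GradedPoly.pd {n : ℕ} {A : Type*} [NormedAddCommGroup A] [NormedSpace ℝ A] {j : ZMod 2}
    {q : Coord n → A} (hq : GradedPoly j q) (i : Fin n) : GradedPoly (j + 1) (pd i q) := by
  induction hq with
  | const a =>
    have : HeatCoeff.pd i (fun _ : Coord n => a) = fun _ => 0 := funext fun u => pd_const a i u
    rw [this]; exact zero _
  | zero j =>
    have : HeatCoeff.pd i (fun _ : Coord n => (0 : A)) = fun _ => 0 :=
      funext fun u => pd_const 0 i u
    rw [this]; exact zero _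
  | @coord k j q hq ih =>
    have : HeatCoeff.pd i (fun u : Coord n => u k • q u) =
        fun u => u k • HeatCoeff.pd i q u + (if i = k then (1 : ℝ) else 0) • q u := by
      funext u
      rw [pd_smul (by fun_prop) (hq.contDiff.differentiable (by simp) u), pd_coord]
    rw [this]
    refine (ih.coord k).add ?_
    -- Modulo 2, lowering the degree by one is raising it by one; this is why the grading is in
    -- `ZMod 2`.
    have h2 : j + 1 + 1 = j := by rw [add_assoc, CharTwo.add_self_eq_zero, add_zero]
    rw [h2]
    exact hq.map ((if i = k then (1 : ℝ) else 0) • LinearMap.id)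
  | @add j q q' hq hq' ih ih' =>
    have : HeatCoeff.pd i (fun u : Coord n => q u + q' u) =
        fun u => HeatCoeff.pd i q u + HeatCoeff.pd i q' u := by
      funext u
      exact pd_add (hq.contDiff.differentiable (by simp) u)
        (hq'.contDiff.differentiable (by simp) u) i
    rw [this]; exact ih.add ih'

/-- A polynomial of odd parity is a sum of monomials of odd degree. -/
theorem GradedPoly.isOddPolynomial {n : ℕ} {A : Type*} [AddCommGroup A] [Module ℝ A]
    {q : Coord n → A} (hq : GradedPoly (1 : ZMod 2) q) : IsOddPolynomial q := by
  -- Both parities have to be treated together, because a coordinate factor exchanges them.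
  have key : ∀ (j : ZMod 2) (q : Coord n → A), GradedPoly j q →
      ∃ c : (Fin n →₀ ℕ) →₀ A, (∀ α ∈ c.support, ((∑ i, α i : ℕ) : ZMod 2) = j) ∧
        ∀ u, q u = c.sum fun α a => (∏ i, (u i) ^ (α i)) • a := by
    intro j q hq
    induction hq with
    | const a =>
      refine ⟨Finsupp.single 0 a, fun α hα => ?_, fun u => ?_⟩
      · have := Finsupp.support_single_subset hα
        simp only [Finset.mem_singleton] at this
        simp [this]
      · rw [Finsupp.sum_single_index] <;> simp
    | zero j => exact ⟨0, by simp, by simp⟩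
    | @coord i j q hq ih =>
      obtain ⟨c, hc, hq⟩ := ih
      -- Multiplication with `u i` raises the exponent of index `i` in each monomial.
      refine ⟨c.mapDomain (fun α => α + Finsupp.single i 1), fun α hα => ?_, fun u => ?_⟩
      · classical
        have := Finsupp.mapDomain_support hα
        simp only [Finset.mem_image] at this
        obtain ⟨β, hβ, rfl⟩ := this
        have h1 : ∑ k, (Finsupp.single i 1 : Fin n →₀ ℕ) k = 1 := by
          simp [Finsupp.single_apply]
        simp only [Finsupp.add_apply, Finset.sum_add_distrib, h1]
        push_cast
        rw [← hc β hβ]; push_cast; rfl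
      · beta_reduce
        rw [Finsupp.sum_mapDomain_index (by simp) (by simp), hq u, Finsupp.smul_sum]
        refine Finsupp.sum_congr fun β _ => ?_
        have h1 : ∏ k, u k ^ (Finsupp.single i 1 : Fin n →₀ ℕ) k = u i := by
          simp [Finsupp.single_apply]
        simp only [Finsupp.add_apply, pow_add, Finset.prod_mul_distrib, h1, smul_smul]
        rw [mul_comm]
    | @add j q q' hq hq' ih ih' =>
      obtain ⟨c, hc, hq⟩ := ih
      obtain ⟨c', hc', hq'⟩ := ih'
      refine ⟨c + c', fun α hα => ?_, fun u => ?_⟩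
      · classical
        rcases Finset.mem_union.1 (Finsupp.support_add hα) with h | h
        exacts [hc _ h, hc' _ h]
      · beta_reduce
        rw [Finsupp.sum_add_index' (by simp) (by simp), hq, hq']
  obtain ⟨c, hc, h⟩ := key 1 q hq
  exact ⟨c, fun α hα => ZMod.natCast_eq_one_iff_odd.1 (hc α hα), h⟩

theorem IsOddPolynomial.neg_apply {n : ℕ} {A : Type*} [AddCommGroup A] [Module ℝ A]
    {q : Coord n → A} (hq : IsOddPolynomial q) (u : Coord n) : q (-u) = -q u := by
  obtain ⟨c, hc, h⟩ := hq
  rw [h, h, Finsupp.sum, Finsupp.sum, ← Finset.sum_neg_distrib]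
  refine Finset.sum_congr rfl fun α hα => ?_
  have : ∏ i, ((-u) i) ^ α i = -∏ i, (u i) ^ α i := by
    have h1 : ∀ i, ((-u) i) ^ α i = (-1) ^ α i * (u i) ^ α i := fun i => by
      rw [PiLp.neg_apply, neg_pow]
    simp only [h1, Finset.prod_mul_distrib, Finset.prod_pow_eq_pow_sum, (hc α hα).neg_one_pow,
      neg_one_mul]
  rw [this, neg_smul]

theorem IsOddPolynomial.apply_zero {n : ℕ} {A : Type*} [AddCommGroup A] [Module ℝ A]
    {q : Coord n → A} (hq : IsOddPolynomial q) : q 0 = 0 := by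
  have h0 := hq.neg_apply 0
  rw [neg_zero, eq_neg_iff_add_eq_zero, ← two_smul ℝ] at h0
  rw [← inv_smul_smul₀ (two_ne_zero (α := ℝ)) (q 0), h0, smul_zero]

/-! ### The algebra of operators on smooth functions -/

section Operators

variable {n : ℕ} {E : Type*} [NormedRing E] [NormedAlgebra ℂ E]

/-- The submodule of smooth functions. -/
def smoothSubmodule (n : ℕ) (E : Type*) [NormedRing E] [NormedAlgebra ℂ E] :
    Submodule ℂ (Coord n → E) where
  carrier := {f | ContDiff ℝ ∞ f}
  add_mem' {f g} (hf : ContDiff ℝ ∞ f) (hg : ContDiff ℝ ∞ g) := hf.add hg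
  zero_mem' := (contDiff_const : ContDiff ℝ ∞ fun _ : Coord n => (0 : E))
  smul_mem' c f (hf : ContDiff ℝ ∞ f) := hf.const_smul c

/-- Smooth functions with values in a normed algebra. -/
def SmoothFun (n : ℕ) (E : Type*) [NormedRing E] [NormedAlgebra ℂ E] : Type _ :=
  smoothSubmodule n E

namespace SmoothFun

instance : AddCommGroup (SmoothFun n E) := inferInstanceAs (AddCommGroup (smoothSubmodule n E))

instance : Module ℂ (SmoothFun n E) := inferInstanceAs (Module ℂ (smoothSubmodule n E))

instance : FunLike (SmoothFun n E) (Coord n) E := ⟨fun f => f.1, Subtype.val_injective⟩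

/-- A smooth function as an element of `SmoothFun`. -/
def mk (f : Coord n → E) (hf : ContDiff ℝ ∞ f) : SmoothFun n E := ⟨f, hf⟩

@[ext] theorem ext {f g : SmoothFun n E} (h : ∀ u, f u = g u) : f = g := Subtype.ext (funext h)

theorem contDiff (f : SmoothFun n E) : ContDiff ℝ ∞ f := f.2

theorem differentiable (f : SmoothFun n E) : Differentiable ℝ f :=
  f.contDiff.differentiable (by simp)

/-- Evaluation at a point. -/
def eval (u : Coord n) : SmoothFun n E →ₗ[ℂ] E where
  toFun f := f u
  map_add' _ _ := rfl
  map_smul' _ _ := rfl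

theorem eval_apply (u : Coord n) (f : SmoothFun n E) : eval u f = f u := rfl

@[simp] theorem add_apply (f g : SmoothFun n E) (u : Coord n) : (f + g) u = f u + g u := rfl

@[simp] theorem sub_apply (f g : SmoothFun n E) (u : Coord n) : (f - g) u = f u - g u := rfl

@[simp] theorem zero_apply (u : Coord n) : (0 : SmoothFun n E) u = 0 := rfl

@[simp] theorem smul_apply (c : ℂ) (f : SmoothFun n E) (u : Coord n) : (c • f) u = c • f u := rfl

theorem sum_apply {κ : Type*} (s : Finset κ) (f : κ → SmoothFun n E) (u : Coord n) :
    (∑ k ∈ s, f k) u = ∑ k ∈ s, f k u := by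
  simp only [← eval_apply, map_sum]

end SmoothFun

/-- Linear operators on smooth functions. -/
abbrev SmoothOp (n : ℕ) (E : Type*) [NormedRing E] [NormedAlgebra ℂ E] : Type _ := Module.End ℂ (SmoothFun n E)

/-- Partial differentiation. -/
def opPd (i : Fin n) : SmoothOp n E where
  toFun f := .mk (pd i f) (contDiff_pd f.contDiff i)
  map_add' f g := by
    ext u
    exact pd_add (f.differentiable u) (g.differentiable u) i
  map_smul' c f := by
    ext u
    have h := pd_smul (𝕜 := ℂ) (c := fun _ => c) (differentiableAt_const c) (f.differentiable u) i
    rw [pd_const, zero_smul, add_zero] at h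
    exact h

/-- Multiplication with a coordinate. -/
def opCoord (i : Fin n) : SmoothOp n E where
  toFun f := .mk (fun u => u i • f u)
    ((show ContDiff ℝ ∞ fun u : Coord n => u i by fun_prop).smul f.contDiff)
  map_add' f g := by ext u; exact smul_add _ _ _
  map_smul' c f := by ext u; exact smul_comm _ _ _

/-- Left multiplication with a constant endomorphism. -/
def opLeft : E →ₗ[ℂ] SmoothOp n E where
  toFun a :=
    { toFun f := .mk (fun u => a * f u)
        (((ContinuousLinearMap.mul ℂ E a).restrictScalars ℝ).contDiff.comp f.contDiff :)
      map_add' f g := by ext u; exact mul_add _ _ _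
      map_smul' c f := by ext u; exact mul_smul_comm _ _ _ }
  map_add' a b := by ext f u; exact add_mul _ _ _
  map_smul' c a := by ext f u; exact smul_mul_assoc _ _ _

/-- The operator `𝓓_μ`. -/
def opCov (F : Matrix (Fin n) (Fin n) ℝ) (μ : Fin n) : SmoothOp n E :=
  opPd μ - ∑ α, ((1 / 2) * Complex.I * (F μ α : ℂ)) • opCoord α

@[simp] theorem opPd_apply (i : Fin n) (f : SmoothFun n E) (u : Coord n) :
    opPd i f u = pd i f u := rfl

@[simp] theorem opCoord_apply (i : Fin n) (f : SmoothFun n E) (u : Coord n) :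
    opCoord i f u = u i • f u := rfl

@[simp] theorem opLeft_apply (a : E) (f : SmoothFun n E) (u : Coord n) :
    opLeft a f u = a * f u := rfl

theorem opCov_apply (F : Matrix (Fin n) (Fin n) ℝ) (μ : Fin n) (f : SmoothFun n E) :
    (opCov F μ f) = covD F μ f := by
  funext u
  simp only [opCov, covD, LinearMap.sub_apply, LinearMap.sum_apply, LinearMap.smul_apply,
    SmoothFun.sub_apply, SmoothFun.sum_apply, SmoothFun.smul_apply, opPd_apply, opCoord_apply, Finset.mul_sum, Finset.sum_smul]
  congr 1
  refine Finset.sum_congr rfl fun α _ => ?_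
  rw [← Complex.coe_smul, smul_smul, mul_assoc _ (F μ α : ℂ)]

/-! ### Canonical commutation relations. -/

theorem opPd_mul_opPd (i j : Fin n) : (opPd i * opPd j : SmoothOp n E) = opPd j * opPd i := by
  ext f u
  exact pd_comm f.contDiff i j u

theorem opCoord_mul_opCoord (i j : Fin n) :
    (opCoord i * opCoord j : SmoothOp n E) = opCoord j * opCoord i := by
  ext f u
  exact smul_comm _ _ _

theorem opPd_mul_opCoord (i j : Fin n) :
    (opPd i * opCoord j : SmoothOp n E) = opCoord j * opPd i + if i = j then 1 else 0 := by
  ext f u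
  have h := pd_smul (c := fun u : Coord n => u j) (u := u) (by fun_prop) (f.differentiable u) i
  rw [pd_coord] at h
  refine h.trans ?_
  split_ifs <;> simp

theorem commute_opLeft_opPd (a : E) (i : Fin n) : Commute (opLeft a) (opPd i) := by
  ext f u
  exact (pd_clm ((ContinuousLinearMap.mul ℂ E a).restrictScalars ℝ) (f.differentiable u) i).symm

theorem commute_opLeft_opCoord (a : E) (i : Fin n) : Commute (opLeft a) (opCoord i) := by
  ext f u
  exact mul_smul_comm _ _ _

theorem commute_opLeft_opCov (F : Matrix (Fin n) (Fin n) ℝ) (a : E) (i : Fin n) :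
    Commute (opLeft a) (opCov F i) :=
  (commute_opLeft_opPd a i).sub_right
    (Commute.sum_right _ _ _ fun α _ => (commute_opLeft_opCoord a α).smul_right _)

theorem opCov_mul_opCoord (F : Matrix (Fin n) (Fin n) ℝ) (i j : Fin n) :
    (opCov F i * opCoord j : SmoothOp n E) =
      opCoord j * opCov F i + if i = j then 1 else 0 := by
  simp only [opCov, sub_mul, mul_sub, opPd_mul_opCoord, Finset.sum_mul, Finset.mul_sum,
    smul_mul_assoc, mul_smul_comm, opCoord_mul_opCoord _ j]
  abel

/-- The curl of a potential linear in u is constant, so the commutator is a scalar. This is what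
closes the letters under commutation with 𝓓². -/
theorem opCov_mul_opCov (F : Matrix (Fin n) (Fin n) ℝ) (i j : Fin n) :
    (opCov F i * opCov F j : SmoothOp n E) =
      opCov F j * opCov F i + ((1 / 2) * Complex.I * ((F i j : ℂ) - F j i)) • 1 := by
  have h : ∀ i j : Fin n, (opCov F i * opCov F j : SmoothOp n E) = opCov F i * opPd j
      - ∑ α, ((1 / 2) * Complex.I * (F j α : ℂ)) • (opCoord α * opCov F i)
      - ((1 / 2) * Complex.I * (F j i : ℂ)) • 1 := by
    intro i j
    conv_lhs => rw [opCov.eq_1 F j]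
    simp only [mul_sub, Finset.mul_sum, mul_smul_comm, opCov_mul_opCoord, smul_add,
      Finset.sum_add_distrib, smul_ite, smul_zero, Finset.sum_ite_eq, Finset.mem_univ, if_true]
    abel
  -- Once the remaining 𝓓_i are expanded, everything but the scalar term is symmetric under exchange
  -- of `i` and `j`.
  have h2 : ∀ i j : Fin n, (opCov F i * opPd j : SmoothOp n E)
      - ∑ α, ((1 / 2) * Complex.I * (F j α : ℂ)) • (opCoord α * opCov F i) =
      opPd i * opPd j - ∑ α, ((1 / 2) * Complex.I * (F i α : ℂ)) • (opCoord α * opPd j)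
       - ∑ α, ((1 / 2) * Complex.I * (F j α : ℂ)) • (opCoord α * opPd i)
       + ∑ α, ∑ β, ((1 / 2) * Complex.I * (F j α : ℂ) * ((1 / 2) * Complex.I * (F i β : ℂ)))
          • (opCoord α * opCoord β) := by
    intro i j
    simp only [opCov, sub_mul, mul_sub, Finset.sum_mul, Finset.mul_sum, smul_mul_assoc,
      mul_smul_comm, smul_sub, Finset.sum_sub_distrib, Finset.smul_sum, smul_smul]
    abel
  rw [h i j, h j i, h2 i j, h2 j i, opPd_mul_opPd i j, Finset.sum_comm
    (f := fun α β : Fin n => ((1 / 2) * Complex.I * (F j α : ℂ) * ((1 / 2) * Complex.I * (F i β : ℂ)))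
          • (opCoord α * opCoord β : SmoothOp n E))]
  simp only [opCoord_mul_opCoord, mul_comm ((1 / 2) * Complex.I * (F j _ : ℂ)), mul_sub, sub_smul]
  abel

/-- The operator `𝓓²`. -/
def opCovSq (F : Matrix (Fin n) (Fin n) ℝ) : SmoothOp n E := ∑ μ, opCov F μ * opCov F μ

theorem opCovSq_apply (F : Matrix (Fin n) (Fin n) ℝ) (f : SmoothFun n E) :
    (opCovSq F f) = covDsq F f := by
  funext u
  simp only [opCovSq, LinearMap.sum_apply, SmoothFun.sum_apply, Module.End.mul_apply,
    opCov_apply, covDsq]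

/-! ### Words in u and 𝓓, and their stability under the commutator with 𝓓². -/

/-- The commutator with `𝓓²`. -/
def opAd (F : Matrix (Fin n) (Fin n) ℝ) : SmoothOp n E →ₗ[ℂ] SmoothOp n E :=
  LinearMap.mulLeft ℂ (opCovSq F : SmoothOp n E) - LinearMap.mulRight ℂ (opCovSq F)

theorem opAd_apply (F : Matrix (Fin n) (Fin n) ℝ) (Q : SmoothOp n E) :
    opAd F Q = opCovSq F * Q - Q * opCovSq F := rfl

/-- The Leibniz rule reduces the action on words to the action on letters and constants. -/
theorem opAd_mul (F : Matrix (Fin n) (Fin n) ℝ) (Q R : SmoothOp n E) :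
    opAd F (Q * R) = opAd F Q * R + Q * opAd F R := by
  simp only [opAd_apply, sub_mul, mul_sub, mul_assoc]
  abel

theorem opAd_opLeft (F : Matrix (Fin n) (Fin n) ℝ) (a : E) :
    opAd F (opLeft a : SmoothOp n E) = 0 := by
  rw [opAd_apply, sub_eq_zero]
  exact (Commute.sum_right _ _ _ fun μ _ =>
    (commute_opLeft_opCov F a μ).mul_right (commute_opLeft_opCov F a μ)).symm

/-- The span of the coordinates and the operators `𝓓_μ`. -/
def genSpan (F : Matrix (Fin n) (Fin n) ℝ) : Submodule ℂ (SmoothOp n E) :=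
  Submodule.span ℂ (range opCoord ∪ range (opCov F))

theorem opCoord_mem (F : Matrix (Fin n) (Fin n) ℝ) (i : Fin n) :
    (opCoord i : SmoothOp n E) ∈ genSpan F := Submodule.subset_span (Or.inl ⟨i, rfl⟩)

theorem opCov_mem (F : Matrix (Fin n) (Fin n) ℝ) (i : Fin n) :
    (opCov F i : SmoothOp n E) ∈ genSpan F := Submodule.subset_span (Or.inr ⟨i, rfl⟩)

/-- If [𝓓_i, R] is the scalar c_i for all i, then [𝓓², R] = 2 ∑ c_i 𝓓_i, which is again linear in
the letters. -/
theorem opAd_genSpan (F : Matrix (Fin n) (Fin n) ℝ) {Q : SmoothOp n E} (hQ : Q ∈ genSpan F) :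
    opAd F Q ∈ genSpan F := by
  suffices h : genSpan F ≤ (genSpan F).comap (opAd F (E := E)) from h hQ
  refine Submodule.span_le.2 ?_
  have key : ∀ (R : SmoothOp n E) (c : Fin n → ℂ),
      (∀ i, opCov F i * R = R * opCov F i + c i • 1) → opAd F R ∈ genSpan F := by
    intro R c h
    have : opAd F R = ∑ i, (2 * c i) • opCov F i := by
      rw [opAd_apply, opCovSq, Finset.sum_mul, Finset.mul_sum, ← Finset.sum_sub_distrib]
      refine Finset.sum_congr rfl fun i _ => ?_
      rw [mul_assoc, h, mul_add, ← mul_assoc, h, add_mul, mul_assoc]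
      simp only [smul_mul_assoc, mul_smul_comm, one_mul, mul_one]
      module
    rw [this]
    exact Submodule.sum_mem _ fun i _ => Submodule.smul_mem _ _ (opCov_mem F i)
  rintro _ (⟨j, rfl⟩ | ⟨j, rfl⟩)
  · refine key _ (fun i => if i = j then 1 else 0) fun i => ?_
    rw [opCov_mul_opCoord]
    split_ifs <;> simp
  · exact key _ _ fun i => opCov_mul_opCov F i j

/-- The span of the words of length `m` with left coefficients. -/
def wordSpan (F : Matrix (Fin n) (Fin n) ℝ) (m : ℕ) : Submodule ℂ (SmoothOp n E) :=
  LinearMap.range opLeft * genSpan F ^ m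

/-- There are finitely many letters and a finite dimensional space of coefficients. This finiteness
turns exp(s Ad) into a matrix exponential. -/
theorem wordSpan_fg [FiniteDimensional ℂ E] (F : Matrix (Fin n) (Fin n) ℝ) (m : ℕ) :
    (wordSpan F m : Submodule ℂ (SmoothOp n E)).FG := by
  refine Submodule.FG.mul ?_ (Submodule.FG.pow ?_ m)
  · rw [LinearMap.range_eq_map]
    exact Module.Finite.fg_top.map _
  · exact Submodule.fg_span ((finite_range _).union (finite_range _))

/-- By the Leibniz rule each term replaces one letter by a combination of letters, so the length
does not change. -/
theorem opAd_pow (F : Matrix (Fin n) (Fin n) ℝ) {m : ℕ} {Q : SmoothOp n E}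
    (hQ : Q ∈ genSpan F ^ m) : opAd F Q ∈ genSpan F ^ m := by
  induction hQ using Submodule.pow_induction_on_right' with
  | algebraMap r =>
    have : opAd F (algebraMap ℂ (SmoothOp n E) r) = 0 := by
      rw [opAd_apply, Algebra.commutes, sub_self]
    rw [this]; exact zero_mem _
  | add x y i hx hy ihx ihy => rw [map_add]; exact add_mem ihx ihy
  | mul_mem i x hx ih a ha =>
    rw [opAd_mul, Submodule.pow_succ]
    exact add_mem (Submodule.mul_mem_mul ih ha) (Submodule.mul_mem_mul hx (opAd_genSpan F ha))

theorem opAd_wordSpan (F : Matrix (Fin n) (Fin n) ℝ) {m : ℕ} {Q : SmoothOp n E}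
    (hQ : Q ∈ wordSpan F m) : opAd F Q ∈ wordSpan F m := by
  refine Submodule.mul_induction_on hQ ?_ ?_
  · rintro _ ⟨a, rfl⟩ x hx
    rw [opAd_mul, opAd_opLeft, zero_mul, zero_add]
    exact Submodule.mul_mem_mul ⟨a, rfl⟩ (opAd_pow F hx)
  · intro x y hx hy
    rw [map_add]; exact add_mem hx hy

theorem wordSpan_mul_mem (F : Matrix (Fin n) (Fin n) ℝ) {m : ℕ} {Q R : SmoothOp n E}
    (hQ : Q ∈ wordSpan F m) (hR : R ∈ genSpan F) : Q * R ∈ wordSpan F (m + 1) := by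
  rw [wordSpan, Submodule.pow_succ, ← mul_assoc]
  exact Submodule.mul_mem_mul hQ hR

theorem wordSpan_mul_pow_mem (F : Matrix (Fin n) (Fin n) ℝ) {m l : ℕ} {Q R : SmoothOp n E}
    (hQ : Q ∈ wordSpan F m) (hR : R ∈ genSpan F ^ l) : Q * R ∈ wordSpan F (m + l) := by
  induction hR using Submodule.pow_induction_on_right' with
  | algebraMap r =>
    rw [Algebra.algebraMap_eq_smul_one, mul_smul_comm, mul_one]
    exact Submodule.smul_mem _ _ hQ
  | add x y i hx hy ihx ihy => rw [mul_add]; exact add_mem ihx ihy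
  | mul_mem i x hx ih a ha => rw [← mul_assoc]; exact wordSpan_mul_mem F ih ha

/-- Left multiplication with a homogeneous polynomial of degree `m` is a combination of words of
length `m`. -/
theorem GradedPoly.exists_wordSpan (F : Matrix (Fin n) (Fin n) ℝ) {m : ℕ} {q : Coord n → E}
    (hq : GradedPoly m q) : ∃ Q ∈ wordSpan F m, ∀ (f : SmoothFun n E) (u : Coord n),
      Q f u = q u * f u := by
  induction hq with
  | const a =>
    refine ⟨opLeft a, ?_, fun f u => rfl⟩
    rw [wordSpan, Submodule.pow_zero, Submodule.mul_one]
    exact ⟨a, rfl⟩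
  | zero j => exact ⟨0, zero_mem _, fun f u => by simp⟩
  | coord i hq ih =>
    obtain ⟨Q, hQ, h⟩ := ih
    refine ⟨Q * opCoord i, wordSpan_mul_mem F hQ (opCoord_mem F i), fun f u => ?_⟩
    rw [Module.End.mul_apply, h, opCoord_apply, mul_smul_comm, smul_mul_assoc]
  | add hq hq' ih ih' =>
    obtain ⟨Q, hQ, h⟩ := ih
    obtain ⟨Q', hQ', h'⟩ := ih'
    refine ⟨Q + Q', add_mem hQ hQ', fun f u => ?_⟩
    rw [LinearMap.add_apply, SmoothFun.add_apply, h, h', add_mul]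

end Operators

section Parity

variable {n : ℕ} {E : Type*} [NormedRing E] [NormedAlgebra ℂ E]

/-! ### Parity of operators acting on polynomials times a Gaussian -/

/-- A smooth function on which every `𝓓_μ` acts as multiplication with a linear function. -/
def IsGaussian (F : Matrix (Fin n) (Fin n) ℝ) (g : Coord n → ℂ) : Prop :=
  ContDiff ℝ ∞ g ∧ ∀ μ, ∃ l : Coord n →ₗ[ℝ] ℂ, ∀ u, covD F μ g u = l u * g u

/-- `f` is the product of `g` and a polynomial of parity `p`. -/
def HasParity (g : Coord n → ℂ) (p : ZMod 2) (f : SmoothFun n E) : Prop :=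
  ∃ q : Coord n → E, GradedPoly p q ∧ ∀ u, f u = g u • q u

theorem GradedPoly.complex_smul {ι : Type*} [AddMonoidWithOne ι] {j : ι} {q : Coord n → E}
    (hq : GradedPoly j q) (c : ℂ) : GradedPoly j (fun u => c • q u) :=
  hq.map ((LinearMap.lsmul ℂ E c).restrictScalars ℝ)

theorem GradedPoly.linear_smul {ι : Type*} [AddMonoidWithOne ι] {j : ι} {q : Coord n → E}
    (hq : GradedPoly j q) (l : Coord n →ₗ[ℝ] ℂ) : GradedPoly (j + 1) (fun u => l u • q u) := by
  have : (fun u => l u • q u) = fun u => ∑ i, u i • (l (basisVec i) • q u) := by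
    funext u
    conv_lhs => rw [EuclideanSpace.eq_sum_basisVec u]
    rw [map_sum, Finset.sum_smul, ← EuclideanSpace.eq_sum_basisVec u]
    exact Finset.sum_congr rfl fun i _ => by rw [map_smul, smul_assoc]
  rw [this]
  exact GradedPoly.sum _ fun i _ => (hq.complex_smul _).coord i

/-- Operators that shift the parity of polynomials times a Gaussian by `p`. -/
def parityOp (F : Matrix (Fin n) (Fin n) ℝ) (p : ZMod 2) : Submodule ℂ (SmoothOp n E) where
  carrier := {Q | ∀ g, IsGaussian F g → ∀ q f, HasParity g q f → HasParity g (q + p) (Q f)}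
  add_mem' {Q R} hQ hR g hg q f hf := by
    obtain ⟨a, ha, h⟩ := hQ g hg q f hf
    obtain ⟨b, hb, h'⟩ := hR g hg q f hf
    exact ⟨_, ha.add hb, fun u => by
      rw [LinearMap.add_apply, SmoothFun.add_apply, h, h', smul_add]⟩
  zero_mem' g hg q f hf := ⟨_, GradedPoly.zero _, fun u => by simp⟩
  smul_mem' c Q hQ g hg q f hf := by
    obtain ⟨a, ha, h⟩ := hQ g hg q f hf
    exact ⟨_, ha.complex_smul c, fun u => by
      rw [LinearMap.smul_apply, SmoothFun.smul_apply, h, smul_comm]⟩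

theorem parityOp_mul {F : Matrix (Fin n) (Fin n) ℝ} {p p' : ZMod 2} {Q R : SmoothOp n E}
    (hQ : Q ∈ parityOp F p) (hR : R ∈ parityOp F p') : Q * R ∈ parityOp F (p' + p) := by
  intro g hg q f hf
  rw [← add_assoc]
  exact hQ g hg _ _ (hR g hg q f hf)

theorem one_mem_parityOp (F : Matrix (Fin n) (Fin n) ℝ) :
    (1 : SmoothOp n E) ∈ parityOp F 0 := by
  intro g hg q f hf
  rwa [add_zero]

theorem opLeft_mem_parityOp (F : Matrix (Fin n) (Fin n) ℝ) (a : E) :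
    (opLeft a : SmoothOp n E) ∈ parityOp F 0 := by
  rintro g hg q f ⟨b, hb, h⟩
  rw [add_zero]
  exact ⟨_, hb.map ((LinearMap.mulLeft ℂ a).restrictScalars ℝ), fun u => by
    rw [opLeft_apply, h, mul_smul_comm]; rfl⟩

theorem opCoord_mem_parityOp (F : Matrix (Fin n) (Fin n) ℝ) (i : Fin n) :
    (opCoord i : SmoothOp n E) ∈ parityOp F 1 := by
  rintro g hg q f ⟨b, hb, h⟩
  exact ⟨_, hb.coord i, fun u => by rw [opCoord_apply, h, smul_comm]⟩

/-- On g·b the product rule gives g·(l b + ∂_i b): one term raises the degree by one, the other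
lowers it by one, and both change the parity. -/
theorem opCov_mem_parityOp (F : Matrix (Fin n) (Fin n) ℝ) (i : Fin n) :
    (opCov F i : SmoothOp n E) ∈ parityOp F 1 := by
  rintro g ⟨hg, hl⟩ q f ⟨b, hb, h⟩
  obtain ⟨l, hl⟩ := hl i
  refine ⟨_, (hb.linear_smul l).add (hb.pd i), fun u => ?_⟩
  have hf : (f : Coord n → E) = fun u => g u • b u := funext h
  rw [opCov_apply, covD, hf, pd_smul (hg.differentiable (by simp) u)
    (hb.contDiff.differentiable (by simp) u)]
  have h1 := hl u
  rw [covD, smul_eq_mul, sub_eq_iff_eq_add] at h1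
  rw [h1]
  module

theorem genSpan_le_parityOp (F : Matrix (Fin n) (Fin n) ℝ) :
    (genSpan F : Submodule ℂ (SmoothOp n E)) ≤ parityOp F 1 := by
  refine Submodule.span_le.2 ?_
  rintro _ (⟨j, rfl⟩ | ⟨j, rfl⟩)
  exacts [opCoord_mem_parityOp F j, opCov_mem_parityOp F j]

/-- Each of the `m` letters shifts the parity by one; the constant coefficient does not change it.
-/
theorem wordSpan_le_parityOp (F : Matrix (Fin n) (Fin n) ℝ) (m : ℕ) :
    (wordSpan F m : Submodule ℂ (SmoothOp n E)) ≤ parityOp F m := by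
  refine Submodule.mul_le.2 ?_
  rintro _ ⟨a, rfl⟩ x hx
  have hx' : x ∈ parityOp F (m : ZMod 2) := by
    induction hx using Submodule.pow_induction_on_right' with
    | algebraMap r =>
      rw [Algebra.algebraMap_eq_smul_one, Nat.cast_zero]
      exact Submodule.smul_mem _ _ (one_mem_parityOp F)
    | add x y i hx hy ihx ihy => exact add_mem ihx ihy
    | mul_mem i x hx ih a ha =>
      have := parityOp_mul ih (genSpan_le_parityOp F ha)
      rwa [add_comm, ← Nat.cast_succ] at this
  simpa using parityOp_mul (opLeft_mem_parityOp F a) hx'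

/-! ### The exponential of the commutator -/

theorem hasSum_exp_smul {𝔸 : Type*} [NormedRing 𝔸] [NormedAlgebra ℂ 𝔸] [CompleteSpace 𝔸] (B : 𝔸)
    (s : ℝ) : HasSum (fun m : ℕ => ((s ^ m / (m.factorial : ℝ) : ℝ) : ℂ) • B ^ m)
      (NormedSpace.exp ((s : ℂ) • B)) := by
  convert NormedSpace.exp_series_hasSum_exp' (𝕂 := ℂ) ((s : ℂ) • B) using 2 with m
  rw [smul_pow, smul_smul]
  push_cast
  rw [div_eq_inv_mul]

theorem continuous_exp_smul {𝔸 : Type*} [NormedRing 𝔸] [NormedAlgebra ℂ 𝔸] [CompleteSpace 𝔸]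
    (B : 𝔸) : Continuous fun s : ℝ => NormedSpace.exp ((s : ℂ) • B) := by
  let _ := NormedAlgebra.restrictScalars ℚ ℂ 𝔸
  exact NormedSpace.exp_continuous.comp (Complex.continuous_ofReal.smul continuous_const)

/-- `Q` lies in a finite dimensional space of operators of parity `p` that is stable under the
commutator with `𝓓²`. -/
def IsAdFinite (F : Matrix (Fin n) (Fin n) ℝ) (p : ZMod 2) (Q : SmoothOp n E) : Prop :=
  ∃ W : Submodule ℂ (SmoothOp n E), W.FG ∧ (∀ w ∈ W, opAd F w ∈ W) ∧ W ≤ parityOp F p ∧ Q ∈ W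

namespace IsAdFinite

variable {F : Matrix (Fin n) (Fin n) ℝ} {p : ZMod 2}

theorem zero : IsAdFinite F p (0 : SmoothOp n E) :=
  ⟨⊥, Submodule.fg_bot, fun w hw => by
    rw [(Submodule.mem_bot ℂ).1 hw, map_zero]; exact zero_mem _, bot_le, zero_mem _⟩

theorem add {Q R : SmoothOp n E} (hQ : IsAdFinite F p Q) (hR : IsAdFinite F p R) :
    IsAdFinite F p (Q + R) := by
  obtain ⟨W, hW, hW', hp, h⟩ := hQ
  obtain ⟨V, hV, hV', hp', h'⟩ := hR
  refine ⟨W ⊔ V, hW.sup hV, fun w hw => ?_, sup_le hp hp', Submodule.add_mem_sup h h'⟩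
  obtain ⟨a, ha, b, hb, rfl⟩ := Submodule.mem_sup.1 hw
  rw [map_add]
  exact Submodule.add_mem_sup (hW' a ha) (hV' b hb)

theorem sum {κ : Type*} (s : Finset κ) {Q : κ → SmoothOp n E}
    (h : ∀ k ∈ s, IsAdFinite F p (Q k)) : IsAdFinite F p (∑ k ∈ s, Q k) :=
  Finset.sum_induction Q (IsAdFinite F p) (fun _ _ => add) zero h

theorem of_wordSpan [FiniteDimensional ℂ E] {m : ℕ} {Q : SmoothOp n E} (hQ : Q ∈ wordSpan F m) :
    IsAdFinite F m Q :=
  ⟨wordSpan F m, wordSpan_fg F m, fun _ => opAd_wordSpan F, wordSpan_le_parityOp F m, hQ⟩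

/-- The series `exp (s Ad) Q` converges, and its sum is a finite combination of operators with
coefficients depending continuously on `s`. -/
theorem exists_hasSum {Q : SmoothOp n E} (hQ : IsAdFinite F p Q) :
    ∃ (d : ℕ) (w : Fin d → SmoothOp n E) (c : Fin d → ℝ → ℂ), (∀ i, w i ∈ parityOp F p) ∧
      (∀ i, Continuous (c i)) ∧ ∀ (s : ℝ) (f : SmoothFun n E) (u : Coord n),
        HasSum (fun m : ℕ => (s ^ m / (m.factorial : ℝ)) • ((opAd F)^[m] Q) f u)
          (∑ i, c i s • w i f u) := by
  obtain ⟨W, hW, hst, hp, hQ⟩ := hQ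
  have : Module.Finite ℂ W := Module.Finite.iff_fg.2 hW
  let b := Module.finBasis ℂ W
  let T : W →ₗ[ℂ] W := (opAd F).restrict hst
  -- The restricted commutator is transported to ℂ^d, whose continuous endomorphisms form a Banach
  -- algebra; `W` carries no norm.
  let B : (Fin (Module.finrank ℂ W) → ℂ) →L[ℂ] (Fin (Module.finrank ℂ W) → ℂ) :=
    LinearMap.toContinuousLinearMap (b.equivFun.toLinearMap ∘ₗ T ∘ₗ b.equivFun.symm.toLinearMap)
  have hB : ∀ x : W, B (b.equivFun x) = b.equivFun (T x) := fun x => by simp [B]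
  have hBm : ∀ m : ℕ, (B ^ m) (b.equivFun ⟨Q, hQ⟩) = b.equivFun ((T ^ m) ⟨Q, hQ⟩) := by
    intro m
    induction m with
    | zero => rfl
    | succ m ih =>
      rw [pow_succ', pow_succ', mul_apply_eq_comp, ih, hB, Module.End.mul_apply]
  have hT : ∀ m : ℕ, ((T ^ m) ⟨Q, hQ⟩ : SmoothOp n E) = (opAd F)^[m] Q := by
    intro m
    induction m with
    | zero => rfl
    | succ m ih =>
      rw [pow_succ', Module.End.mul_apply, Function.iterate_succ_apply', ← ih]
      rfl
  let x : ℝ → Fin (Module.finrank ℂ W) → ℂ :=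
    fun s => NormedSpace.exp ((s : ℂ) • B) (b.equivFun ⟨Q, hQ⟩)
  have hx : Continuous x := (continuous_exp_smul B).clm_apply continuous_const
  refine ⟨_, fun i => (b i : SmoothOp n E), fun i s => x s i, fun i => hp (b i).2,
    fun i => (continuous_apply i).comp hx, fun s f u => ?_⟩
  -- Applying an operator to `f` and evaluating at `u` is linear in its coordinates, hence
  -- continuous in finite dimension, so it carries convergence of the exponential series to
  -- pointwise convergence.
  let ev : (Fin (Module.finrank ℂ W) → ℂ) →ₗ[ℂ] E :=
    SmoothFun.eval u ∘ₗ LinearMap.applyₗ f ∘ₗ W.subtype ∘ₗ b.equivFun.symm.toLinearMap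
  have hev : ∀ y, ev y = ∑ i, y i • (b i : SmoothOp n E) f u := by
    intro y
    simp only [ev, LinearMap.comp_apply, LinearEquiv.coe_coe, Module.Basis.equivFun_symm_apply,
      map_sum, map_smul, Submodule.subtype_apply, LinearMap.applyₗ_apply_apply,
      SmoothFun.eval_apply]
  have h1 := (hasSum_exp_smul B s).mapL
    (ContinuousLinearMap.apply ℂ _ (b.equivFun ⟨Q, hQ⟩))
  have h2 := h1.mapL (LinearMap.toContinuousLinearMap ev)
  have h3 : (∑ i, x s i • (b i : SmoothOp n E) f u) = ev (x s) := (hev _).symm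
  have h4 : (fun m : ℕ => (s ^ m / (m.factorial : ℝ)) • ((opAd F)^[m] Q) f u) =
      fun m : ℕ => ev ((((s ^ m / (m.factorial : ℝ) : ℝ) : ℂ) • B ^ m) (b.equivFun ⟨Q, hQ⟩)) := by
    funext m
    have h5 : ev ((B ^ m) (b.equivFun ⟨Q, hQ⟩)) = ((opAd F)^[m] Q) f u := by
      rw [hBm, ← hT]
      simp only [ev, LinearMap.comp_apply, LinearEquiv.coe_coe, LinearEquiv.symm_apply_apply,
        Submodule.subtype_apply, LinearMap.applyₗ_apply_apply, SmoothFun.eval_apply]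
    rw [smul_apply, map_smul, h5, Complex.coe_smul]
  rw [h3, h4]
  exact h2

end IsAdFinite

/-! ### Continuous families of operators -/

/-- A family of operators that on smooth functions is a finite combination of operators of parity
`p` with continuous coefficients. -/
def IsParityFamily (F : Matrix (Fin n) (Fin n) ℝ) (p : ZMod 2)
    (V : ℝ → (Coord n → E) → Coord n → E) : Prop :=
  ∃ (ι : Type) (_ : Fintype ι) (w : ι → SmoothOp n E) (c : ι → ℝ → ℂ),
    (∀ i, w i ∈ parityOp F p) ∧ (∀ i, Continuous (c i)) ∧
      ∀ (s : ℝ) (f : SmoothFun n E) (u : Coord n), V s f u = ∑ i, c i s • w i f u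

namespace IsParityFamily

variable {F : Matrix (Fin n) (Fin n) ℝ} {p p' : ZMod 2}
  {V V' : ℝ → (Coord n → E) → Coord n → E}

theorem id : IsParityFamily F 0 (fun _ (f : Coord n → E) => f) :=
  ⟨Unit, inferInstance, fun _ => 1, fun _ _ => 1, fun _ => one_mem_parityOp F,
    fun _ => continuous_const, fun s f u => by simp⟩

theorem comp (hV : IsParityFamily F p V) (hV' : IsParityFamily F p' V') :
    IsParityFamily F (p' + p) (fun s f => V s (V' s f)) := by
  obtain ⟨ι, _, w, c, hw, hc, h⟩ := hV
  obtain ⟨κ, _, w', c', hw', hc', h'⟩ := hV'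
  refine ⟨ι × κ, inferInstance, fun i => w i.1 * w' i.2, fun i s => c i.1 s * c' i.2 s,
    fun i => parityOp_mul (hw _) (hw' _), fun i => (hc _).mul (hc' _), fun s f u => ?_⟩
  -- The formula for `V` is available on smooth functions only, so the inner value has to be
  -- recognized as one.
  have h1 : V' s f = ((∑ k, c' k s • w' k f : SmoothFun n E) : Coord n → E) := by
    funext v
    rw [h', SmoothFun.sum_apply]
    rfl
  beta_reduce
  rw [h1, h, Fintype.sum_prod_type]
  refine Finset.sum_congr rfl fun i _ => ?_
  rw [map_sum, SmoothFun.sum_apply, Finset.smul_sum]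
  refine Finset.sum_congr rfl fun k _ => ?_
  rw [map_smul, SmoothFun.smul_apply, smul_smul, Module.End.mul_apply]

theorem continuous_apply (hV : IsParityFamily F p V) (f : SmoothFun n E) (u : Coord n) :
    Continuous fun s => V s f u := by
  obtain ⟨ι, _, w, c, hw, hc, h⟩ := hV
  simp only [h]
  exact continuous_finsetSum _ fun i _ => (hc i).smul continuous_const

/-- The operators do not depend on `s`: only the scalar coefficients are integrated, and their
primitives are again continuous. -/
theorem integral [CompleteSpace E] (hV : IsParityFamily F p V) :
    IsParityFamily F p (fun t f u => ∫ s in (0 : ℝ)..t, V s f u) := by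
  obtain ⟨ι, _, w, c, hw, hc, h⟩ := hV
  refine ⟨ι, inferInstance, w, fun i t => ∫ s in (0 : ℝ)..t, c i s, hw, fun i =>
    intervalIntegral.continuous_primitive (fun a b => (hc i).intervalIntegrable a b) 0,
    fun t f u => ?_⟩
  simp only [h]
  rw [intervalIntegral.integral_finsetSum (f := fun i s => c i s • w i f u) fun i _ =>
    ((hc i).smul continuous_const).intervalIntegrable _ _]
  exact Finset.sum_congr rfl fun i _ => intervalIntegral.integral_smul_const _ _

end IsParityFamily

end Parity

/-! ### The operators of the perturbation expansion -/

theorem real_smul_one_mul {E : Type*} [NormedRing E] [NormedAlgebra ℂ E] (r : ℝ) (a : E) :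
    (r • (1 : E)) * a = r • a := by
  rw [← Complex.coe_smul, ← Complex.coe_smul, smul_mul_assoc, one_mul]

namespace NormalData

variable {n N : ℕ} (D : NormalData n N)

/-- A coefficient of degree `m` followed by a word of length `l` is a combination of words of length
`m + l`. -/
theorem isAdFinite_coeff_mul {p : ZMod 2} {m l : ℕ} {q : Coord n → EndF N} (hq : GradedPoly m q)
    (hp : ((m + l : ℕ) : ZMod 2) = p) {R : SmoothOp n (EndF N)} (hR : R ∈ genSpan D.F ^ l) :
    ∃ Q, IsAdFinite D.F p Q ∧ ∀ (f : SmoothFun n (EndF N)) (u : Coord n),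
      Q f u = q u * R f u := by
  obtain ⟨Q, hQ, h⟩ := hq.exists_wordSpan D.F
  refine ⟨Q * R, ?_, fun f u => by rw [Module.End.mul_apply, h]⟩
  rw [← hp]
  exact IsAdFinite.of_wordSpan (wordSpan_mul_pow_mem D.F hQ hR)

/-- Negative degrees, which occur in Y_0, Z_0 and Z_1, give the zero operator. -/
theorem isAdFinite_hom_mul {p : ZMod 2} (g : Coord n → EndF N) (j : ℤ) (l : ℕ)
    (hp : ((j + l : ℤ) : ZMod 2) = p) {R : SmoothOp n (EndF N)} (hR : R ∈ genSpan D.F ^ l) :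
    ∃ Q, IsAdFinite D.F p Q ∧ ∀ (f : SmoothFun n (EndF N)) (u : Coord n),
      Q f u = hom g j u * R f u := by
  cases j with
  | ofNat m =>
    refine D.isAdFinite_coeff_mul (GradedPoly.hom_natCast g m) ?_ hR
    rw [← hp]; simp
  | negSucc m =>
    refine ⟨0, IsAdFinite.zero, fun f u => ?_⟩
    change (0 : EndF N) = 0 * R f u
    rw [zero_mul]

/-- X_k has degree k and meets two 𝓓's; Y_k has degrees k - 1 and k + 1 and meets one; Z_k has
degrees k - 2, k and k + 2 and meets none. All total lengths agree with k modulo 2, since each power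
of F moves the degree by two. -/
theorem exists_Lk (k : ℕ) : ∃ Q, IsAdFinite D.F (k : ZMod 2) Q ∧
    ∀ f : SmoothFun n (EndF N), D.Lk k f = Q f := by
  have hX : ∀ μ ν, ∃ Q, IsAdFinite D.F (k : ZMod 2) Q ∧ ∀ (f : SmoothFun n (EndF N)) u,
      Q f u = D.Xk k μ ν u • covD D.F μ (covD D.F ν f) u := by
    intro μ ν
    have hq := (GradedPoly.hom_natCast (fun v => D.X v μ ν) k).map
      (LinearMap.toSpanSingleton ℝ (EndF N) 1)
    obtain ⟨Q, hQ, h⟩ := D.isAdFinite_coeff_mul (p := k) (l := 2) hq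
      (by push_cast; rw [show (2 : ZMod 2) = 0 from rfl, add_zero])
      (R := opCov D.F μ * opCov D.F ν)
      (by rw [Submodule.pow_succ, Submodule.pow_one]; exact Submodule.mul_mem_mul (opCov_mem _ _) (opCov_mem _ _))
    refine ⟨Q, hQ, fun f u => ?_⟩
    rw [h, Module.End.mul_apply, opCov_apply, opCov_apply]
    exact real_smul_one_mul _ _
  have hY : ∀ μ, ∃ Q, IsAdFinite D.F (k : ZMod 2) Q ∧ ∀ (f : SmoothFun n (EndF N)) u,
      Q f u = D.Yk k μ u * covD D.F μ f u := by
    intro μ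
    have hR : opCov D.F μ ∈ (genSpan D.F ^ 1 : Submodule ℂ (SmoothOp n (EndF N))) := by
      rw [pow_one]; exact opCov_mem _ _
    obtain ⟨Q, hQ, h⟩ := D.isAdFinite_hom_mul (p := k) (D.Y0 μ) ((k : ℤ) - 1) 1 (by simp) hR
    obtain ⟨Q', hQ', h'⟩ := D.isAdFinite_hom_mul (p := k) (D.Y1 μ) ((k : ℤ) + 1) 1
      (by push_cast; rw [add_assoc, show (1 + 1 : ZMod 2) = 0 from rfl, add_zero]) hR
    refine ⟨Q + Q', hQ.add hQ', fun f u => ?_⟩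
    rw [LinearMap.add_apply, SmoothFun.add_apply, h, h', Yk, add_mul, opCov_apply]
  have hZ : ∃ Q, IsAdFinite D.F (k : ZMod 2) Q ∧ ∀ (f : SmoothFun n (EndF N)) u,
      Q f u = D.Zk k u * f u := by
    have hR : (1 : SmoothOp n (EndF N)) ∈ genSpan D.F ^ 0 := by
      rw [Submodule.pow_zero]; exact Submodule.one_le.1 le_rfl
    obtain ⟨Q, hQ, h⟩ := D.isAdFinite_hom_mul (p := k) D.Z0 ((k : ℤ) - 2) 0
      (by push_cast; rw [show (2 : ZMod 2) = 0 from rfl, sub_zero, add_zero]) hR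
    obtain ⟨Q', hQ', h'⟩ := D.isAdFinite_hom_mul (p := k) D.Z1 (k : ℤ) 0 (by simp) hR
    obtain ⟨Q'', hQ'', h''⟩ := D.isAdFinite_hom_mul (p := k) D.Z2 ((k : ℤ) + 2) 0
      (by push_cast; rw [show (2 : ZMod 2) = 0 from rfl, add_zero, add_zero]) hR
    refine ⟨Q + Q' + Q'', (hQ.add hQ').add hQ'', fun f u => ?_⟩
    rw [LinearMap.add_apply, LinearMap.add_apply, SmoothFun.add_apply, SmoothFun.add_apply, h, h',
      h'', Zk, add_mul, add_mul, Module.End.one_apply]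
  choose QX hQX hX using hX
  choose QY hQY hY using hY
  obtain ⟨QZ, hQZ, hZ⟩ := hZ
  refine ⟨∑ μ, ∑ ν, QX μ ν + ∑ μ, QY μ + QZ, ((IsAdFinite.sum _ fun μ _ =>
    IsAdFinite.sum _ fun ν _ => hQX μ ν).add (IsAdFinite.sum _ fun μ _ => hQY μ)).add hQZ,
    fun f => ?_⟩
  funext u
  simp only [Lk, LinearMap.add_apply, SmoothFun.add_apply, LinearMap.sum_apply,
    SmoothFun.sum_apply, hX, hY, hZ]

/-- 𝓓² preserves smoothness, so agreement on smooth functions passes to iterated commutators. -/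
theorem iterate_adDsq_apply {F : Matrix (Fin n) (Fin n) ℝ} {Q : Op n N}
    {Q' : SmoothOp n (EndF N)} (h : ∀ f : SmoothFun n (EndF N), Q f = Q' f) (m : ℕ)
    (f : SmoothFun n (EndF N)) : ((adDsq F)^[m] Q) f = ((opAd F)^[m] Q') f := by
  induction m generalizing f with
  | zero => exact h f
  | succ m ih =>
    rw [Function.iterate_succ_apply', Function.iterate_succ_apply', opAd_apply]
    funext u
    rw [adDsq, ih, ← opCovSq_apply, ← opCovSq_apply, ih]
    rfl

theorem exists_hasSum_conjTerm (k : ℕ) :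
    ∃ (d : ℕ) (w : Fin d → SmoothOp n (EndF N)) (c : Fin d → ℝ → ℂ),
      (∀ i, w i ∈ parityOp D.F k) ∧ (∀ i, Continuous (c i)) ∧
      ∀ (s : ℝ) (f : SmoothFun n (EndF N)) (u : Coord n),
        HasSum (conjTerm D.F (D.Lk k) s f u) (∑ i, c i s • w i f u) := by
  obtain ⟨Q, hQ, h⟩ := D.exists_Lk k
  obtain ⟨d, w, c, hw, hc, hs⟩ := hQ.exists_hasSum
  refine ⟨d, w, c, hw, hc, fun s f u => ?_⟩
  have : conjTerm D.F (D.Lk k) s f u =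
      fun m : ℕ => (s ^ m / (m.factorial : ℝ)) • ((opAd D.F)^[m] Q) f u := by
    funext m
    rw [conjTerm, iterate_adDsq_apply h]
  rw [this]
  exact hs s f u

theorem summable_conjTerm (k : ℕ) (s : ℝ) (f : SmoothFun n (EndF N)) (u : Coord n) :
    Summable (conjTerm D.F (D.Lk k) s f u) := by
  obtain ⟨d, w, c, -, -, hs⟩ := D.exists_hasSum_conjTerm k
  exact (hs s f u).summable

theorem isParityFamily_Vk (k : ℕ) : IsParityFamily D.F (k : ZMod 2) (D.Vk k) := by
  obtain ⟨d, w, c, hw, hc, hs⟩ := D.exists_hasSum_conjTerm k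
  exact ⟨Fin d, inferInstance, w, c, hw, hc, fun s f u => (hs s f u).tsum_eq⟩

/-- The head of the list acts first, at the latest time; each recursion step is one composition and
one integral. -/
theorem isParityFamily_volterra (js : List ℕ) :
    IsParityFamily D.F (js.sum : ZMod 2) (volterra D.Vk js) := by
  induction js with
  | nil =>
    rw [List.sum_nil, Nat.cast_zero]
    exact IsParityFamily.id
  | cons j js ih =>
    rw [List.sum_cons, Nat.cast_add]
    exact (ih.comp (D.isParityFamily_Vk j)).integral

theorem intervalIntegrable_volterra (j : ℕ) (js : List ℕ) (t : ℝ) (f : SmoothFun n (EndF N))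
    (u : Coord n) :
    IntervalIntegrable (fun s => volterra D.Vk js s (D.Vk j s f) u) volume 0 t :=
  (((D.isParityFamily_volterra js).comp (D.isParityFamily_Vk j)).continuous_apply
    f u).intervalIntegrable 0 t

/-- `T_k(t)` maps a Gaussian to the product with a polynomial of the parity of `k`. -/
theorem exists_Tk_gaussian (k : ℕ) (t : ℝ) {g : Coord n → ℂ} (hg : IsGaussian D.F g) :
    ∃ q : Coord n → EndF N, GradedPoly (k : ZMod 2) q ∧
      ∀ u, D.Tk k t (fun v => g v • (1 : EndF N)) u = g u • q u := by
  let f : SmoothFun n (EndF N) := .mk (fun v => g v • (1 : EndF N)) (hg.1.smul contDiff_const)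
  have hf : HasParity g 0 f := ⟨fun _ => 1, GradedPoly.const 1, fun u => rfl⟩
  have key : ∀ c : Composition k, ∃ q : Coord n → EndF N, GradedPoly (k : ZMod 2) q ∧
      ∀ u, volterra D.Vk c.blocks t f u = g u • q u := by
    intro c
    have h := D.isParityFamily_volterra c.blocks
    -- The blocks of every composition sum to `k`, so all summands of T_k share one parity.
    rw [c.blocks_sum] at h
    obtain ⟨ι, _, w, a, hw, -, h⟩ := h
    choose q hq hq' using fun i => hw i g hg 0 f hf
    refine ⟨fun u => ∑ i, a i t • q i u, ?_, fun u => ?_⟩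
    · refine GradedPoly.sum _ fun i _ => ?_
      have := (hq i).complex_smul (a i t)
      rwa [zero_add] at this
    · rw [h, Finset.smul_sum]
      exact Finset.sum_congr rfl fun i _ => by rw [hq', smul_comm]
  choose q hq h using key
  refine ⟨fun u => ∑ c, q c u, GradedPoly.sum _ fun c _ => hq c, fun u => ?_⟩
  rw [Finset.smul_sum]
  exact Finset.sum_congr rfl fun c _ => h c u

/-- The coefficient `b_k` is a polynomial of the parity of `k`. -/
theorem gradedPoly_b (k : ℕ) (t : ℝ) (hg : IsGaussian D.F (U0 D.F t))
    (h0 : ∀ u, U0 D.F t u ≠ 0) : GradedPoly (k : ZMod 2) (D.b k t) := by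
  obtain ⟨q, hq, h⟩ := D.exists_Tk_gaussian k t hg
  have : D.b k t = fun u => ((t ^ (-(k : ℝ) / 2) : ℝ) : ℂ) • q u := by
    funext u
    rw [b, h, smul_smul, mul_assoc, inv_mul_cancel₀ (h0 u), mul_one]
  rw [this]
  exact hq.complex_smul _

end NormalData

/-! ### The function `sinh x / x` -/

/-- `sinh x / x`, continued by `1`. -/
def sinhc (x : ℝ) : ℝ := if x = 0 then 1 else Real.sinh x / x

theorem hasSum_sinhc (x : ℝ) :
    HasSum (fun m : ℕ => x ^ (2 * m) / ((2 * m + 1).factorial : ℝ)) (sinhc x) := by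
  rcases eq_or_ne x 0 with rfl | hx
  · rw [sinhc, if_pos rfl]
    convert hasSum_single (f := fun m : ℕ => (0 : ℝ) ^ (2 * m) / ((2 * m + 1).factorial : ℝ)) 0 ?_
    · simp
    · intro m hm
      simp [hm]
  · rw [sinhc, if_neg hx]
    have h : (fun m : ℕ => x ^ (2 * m) / ((2 * m + 1).factorial : ℝ)) =
        fun m : ℕ => x ^ (2 * m + 1) / ((2 * m + 1).factorial : ℝ) / x := by
      funext m
      rw [pow_succ, div_right_comm, mul_div_cancel_right₀ _ hx]
    rw [h]
    exact (Real.hasSum_sinh x).div_const x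

theorem one_le_sinhc (x : ℝ) : 1 ≤ sinhc x := by
  have h := le_hasSum (hasSum_sinhc x) 0 fun m _ => by
    rw [pow_mul]; positivity
  simpa using h

theorem sinhc_pos (x : ℝ) : 0 < sinhc x := lt_of_lt_of_le one_pos (one_le_sinhc x)

/-- Termwise comparison of power series. With `one_le_sinhc` it gives the Gaussian bound for the
initial condition. -/
theorem sinhc_le_cosh (x : ℝ) : sinhc x ≤ Real.cosh x := by
  refine hasSum_le (fun m => ?_) (hasSum_sinhc x) (Real.hasSum_cosh x)
  have h0 : 0 ≤ x ^ (2 * m) := by rw [pow_mul]; positivity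
  have h1 : ((2 * m).factorial : ℝ) ≤ ((2 * m + 1).factorial : ℝ) := by
    exact_mod_cast Nat.factorial_le (Nat.le_succ _)
  gcongr

/-- The product is sinh(sl)/l, read as s for l = 0; in this form zero eigenvalues and s = 0 are
included. -/
theorem hasDerivAt_mul_sinhc (l t : ℝ) :
    HasDerivAt (fun s => s * sinhc (s * l)) (Real.cosh (t * l)) t := by
  rcases eq_or_ne l 0 with rfl | hl
  · simpa [sinhc] using hasDerivAt_id' t
  · have h : (fun s => s * sinhc (s * l)) = fun s => Real.sinh (s * l) / l := by
      funext s
      rcases eq_or_ne s 0 with rfl | hs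
      · simp
      · rw [sinhc, if_neg (mul_ne_zero hs hl)]
        field_simp
    rw [h]
    have := (((hasDerivAt_id t).mul_const l).sinh).div_const l
    simpa [hl] using this

theorem tendsto_sinhc (l : ℝ) : Tendsto (fun t => sinhc (t * l)) (𝓝[>] 0) (𝓝 1) := by
  have h := (hasDerivAt_mul_sinhc l 0).tendsto_slope_zero_right
  simp only [zero_add, zero_mul, sub_zero, Real.cosh_zero, smul_eq_mul] at h
  refine h.congr' ?_
  filter_upwards [self_mem_nhdsWithin] with t ht
  rw [← mul_assoc, inv_mul_cancel₀ (ne_of_gt ht), one_mul]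

/-- `l coth (t l)`, continued to `l = 0`. -/
def cothFun (l t : ℝ) : ℝ := t⁻¹ * (Real.cosh (t * l) / sinhc (t * l))

/-- The Riccati equation c' = l² - c², which drives the quadratic part of the exponent of U₀. -/
theorem hasDerivAt_cothFun (l : ℝ) {t : ℝ} (ht : 0 < t) :
    HasDerivAt (cothFun l) (l ^ 2 - cothFun l t ^ 2) t := by
  have h1 : cothFun l = fun s => Real.cosh (s * l) / (s * sinhc (s * l)) := by
    funext s
    rw [cothFun, inv_mul_eq_div, div_div, mul_comm (sinhc _)]
  have hs := sinhc_pos (t * l)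
  have hd := ((((hasDerivAt_id t).mul_const l).cosh).div (hasDerivAt_mul_sinhc l t)
    (by positivity))
  have hsinh : Real.sinh (t * l) * l = l ^ 2 * (t * sinhc (t * l)) := by
    rcases eq_or_ne l 0 with rfl | hl
    · simp
    · rw [sinhc, if_neg (by positivity)]
      field_simp
  rw [h1]
  refine hd.congr_deriv ?_
  simp only [id, one_mul, hsinh]
  generalize sinhc (t * l) = S at hs
  field_simp

theorem hasDerivAt_log_mul_sinhc (l : ℝ) {t : ℝ} (ht : 0 < t) :
    HasDerivAt (fun s => Real.log (4 * Real.pi * (s * sinhc (s * l)))) (cothFun l t) t := by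
  have hs := sinhc_pos (t * l)
  have hp := Real.pi_pos
  refine (((hasDerivAt_mul_sinhc l t).const_mul (4 * Real.pi)).log (by positivity)).congr_deriv ?_
  rw [cothFun]
  field_simp

/-! ### Diagonalization -/

section Diagonal

variable {n : ℕ}

/-- The unitary matrix `V` diagonalizes `iF` with eigenvalues `l`. -/
structure Diagonalizes (F : Matrix (Fin n) (Fin n) ℝ) (V : Matrix (Fin n) (Fin n) ℂ)
    (l : Fin n → ℝ) : Prop where
  mul_star : V * V.conjTranspose = 1
  star_mul : V.conjTranspose * V = 1
  eq : Complex.I • F.map (fun x : ℝ => (x : ℂ)) =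
    V * Matrix.diagonal (fun j => (l j : ℂ)) * V.conjTranspose

/-- A real antisymmetric matrix times i is Hermitian, so the spectral theorem applies. -/
theorem exists_diagonalizes {F : Matrix (Fin n) (Fin n) ℝ} (hF : F.transpose = -F) :
    ∃ V l, Diagonalizes F V l := by
  have hG : (Complex.I • F.map (fun x : ℝ => (x : ℂ))).IsHermitian := by
    ext i j
    have : F j i = -F i j := congrFun (congrFun hF i) j
    simp [Matrix.conjTranspose_apply, this]
  refine ⟨hG.eigenvectorUnitary, hG.eigenvalues, ?_, ?_, ?_⟩
  · exact Unitary.coe_mul_star_self hG.eigenvectorUnitary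
  · exact Unitary.coe_star_mul_self hG.eigenvectorUnitary
  · exact hG.spectral_theorem

/-- The matrix with eigenvalues `d` in the basis given by `V`. -/
def conjDiag (V : Matrix (Fin n) (Fin n) ℂ) (d : Fin n → ℝ) : Matrix (Fin n) (Fin n) ℂ :=
  V * Matrix.diagonal (fun j => (d j : ℂ)) * V.conjTranspose

theorem conjDiag_smul (V : Matrix (Fin n) (Fin n) ℂ) (c : ℝ) (d : Fin n → ℝ) :
    (c : ℂ) • conjDiag V d = conjDiag V (fun j => c * d j) := by
  have : Matrix.diagonal (fun j => ((c * d j : ℝ) : ℂ)) =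
      (c : ℂ) • Matrix.diagonal (fun j => (d j : ℂ)) := by
    ext i j
    by_cases hij : i = j <;> simp [hij]
  rw [conjDiag, conjDiag, this, Matrix.mul_smul, Matrix.smul_mul]

/-- Matrix power series can thus be summed eigenvalue by eigenvalue. -/
theorem hasSum_conjDiag (V : Matrix (Fin n) (Fin n) ℂ) {a : ℕ → Fin n → ℝ} {d : Fin n → ℝ} (ha : ∀ j, HasSum (a · j) (d j)) :
    HasSum (fun m => conjDiag V (a m)) (conjDiag V d) := by
  have h1 : HasSum (fun m j => (a m j : ℂ)) (fun j => (d j : ℂ)) :=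
    Pi.hasSum.2 fun j => (Complex.hasSum_ofReal.2 (ha j))
  let Φ : Matrix (Fin n) (Fin n) ℂ →+ Matrix (Fin n) (Fin n) ℂ :=
    (AddMonoidHom.mulRight V.conjTranspose).comp (AddMonoidHom.mulLeft V)
  have hΦ : Continuous Φ :=
    (continuous_const.matrix_mul continuous_id).matrix_mul continuous_const
  exact h1.matrix_diagonal.map Φ hΦ

namespace Diagonalizes

variable {F : Matrix (Fin n) (Fin n) ℝ} {V : Matrix (Fin n) (Fin n) ℂ} {l : Fin n → ℝ}


theorem conjDiag_mul (h : Diagonalizes F V l) (d d' : Fin n → ℝ) :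
    conjDiag V d * conjDiag V d' = conjDiag V (fun j => d j * d' j) := by
  calc conjDiag V d * conjDiag V d'
      = V * Matrix.diagonal (fun j => (d j : ℂ)) * (V.conjTranspose * V) *
        Matrix.diagonal (fun j => (d' j : ℂ)) * V.conjTranspose := by
        simp only [conjDiag, Matrix.mul_assoc]
    _ = _ := by
        rw [h.star_mul, Matrix.mul_one, Matrix.mul_assoc V, Matrix.diagonal_mul_diagonal]
        simp [conjDiag]

theorem conjDiag_one (h : Diagonalizes F V l) : conjDiag V (fun _ => 1) = 1 := by
  simp [conjDiag, h.mul_star]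

theorem conjDiag_pow (h : Diagonalizes F V l) (d : Fin n → ℝ) (m : ℕ) :
    conjDiag V d ^ m = conjDiag V (fun j => d j ^ m) := by
  induction m with
  | zero => simpa using h.conjDiag_one.symm
  | succ m ih => rw [pow_succ, ih, h.conjDiag_mul]; simp only [pow_succ]

theorem conjDiag_inv (h : Diagonalizes F V l) {d : Fin n → ℝ} (hd : ∀ j, d j ≠ 0) :
    (conjDiag V d)⁻¹ = conjDiag V (fun j => (d j)⁻¹) := by
  refine Matrix.inv_eq_right_inv ?_
  rw [h.conjDiag_mul]
  simp only [mul_inv_cancel₀ (hd _), h.conjDiag_one]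

theorem det_conjDiag (h : Diagonalizes F V l) (d : Fin n → ℝ) : (conjDiag V d).det = ((∏ j, d j : ℝ) : ℂ) := by
  have hV : V.det * V.conjTranspose.det = 1 := by
    rw [← Matrix.det_mul, h.mul_star, Matrix.det_one]
  rw [conjDiag, Matrix.det_mul, Matrix.det_mul, Matrix.det_diagonal, mul_right_comm, hV, one_mul]
  push_cast
  rfl

theorem trace_conjDiag (h : Diagonalizes F V l) (d : Fin n → ℝ) : (conjDiag V d).trace = ((∑ j, d j : ℝ) : ℂ) := by
  rw [conjDiag, Matrix.trace_mul_comm, ← Matrix.mul_assoc, h.star_mul, Matrix.one_mul,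
    Matrix.trace_diagonal]
  push_cast
  rfl

theorem tiF_eq (h : Diagonalizes F V l) (t : ℝ) : tiF F t = conjDiag V (fun j => t * l j) := by
  rw [← conjDiag_smul V, tiF, mul_smul, h.eq]
  rfl

theorem matCosh_eq (h : Diagonalizes F V l) (t : ℝ) : matCosh (tiF F t) = conjDiag V (fun j => Real.cosh (t * l j)) := by
  refine HasSum.tsum_eq ?_
  convert hasSum_conjDiag V fun j => Real.hasSum_cosh (t * l j) using 2 with m
  rw [h.tiF_eq, h.conjDiag_pow]
  have := conjDiag_smul V (((2 * m).factorial : ℝ)⁻¹) (fun j => (t * l j) ^ (2 * m))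
  push_cast at this
  rw [this]
  simp only [div_eq_inv_mul]

theorem matSinhc_eq (h : Diagonalizes F V l) (t : ℝ) : matSinhc (tiF F t) = conjDiag V (fun j => sinhc (t * l j)) := by
  refine HasSum.tsum_eq ?_
  convert hasSum_conjDiag V fun j => hasSum_sinhc (t * l j) using 2 with m
  rw [h.tiF_eq, h.conjDiag_pow]
  have := conjDiag_smul V (((2 * m + 1).factorial : ℝ)⁻¹) (fun j => (t * l j) ^ (2 * m))
  push_cast at this
  rw [this]
  simp only [div_eq_inv_mul]

theorem M_eq (h : Diagonalizes F V l) (t : ℝ) : M F t = conjDiag V (fun j => cothFun (l j) t) := by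
  rw [M, h.matCosh_eq, h.matSinhc_eq, h.conjDiag_inv fun j => (sinhc_pos _).ne', h.conjDiag_mul,
    ← Complex.ofReal_inv, conjDiag_smul V]
  rfl

/-- The determinant is a product of positive numbers, so the principal complex power is the positive
real root. -/
theorem J_eq (h : Diagonalizes F V l) (t : ℝ) :
    J F t = ((Real.exp (∑ j, -(1 / 2) * Real.log (sinhc (t * l j))) : ℝ) : ℂ) := by
  have hp : 0 < ∏ j, (sinhc (t * l j))⁻¹ := Finset.prod_pos fun j _ => inv_pos.2 (sinhc_pos _)
  rw [J, h.matSinhc_eq, h.conjDiag_inv fun j => (sinhc_pos _).ne', h.det_conjDiag,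
    show (1 / 2 : ℂ) = ((1 / 2 : ℝ) : ℂ) by push_cast; rfl, ← Complex.ofReal_cpow hp.le,
    Real.rpow_def_of_pos hp, Real.log_prod fun j _ => (inv_pos.2 (sinhc_pos _)).ne',
    Finset.sum_mul]
  simp only [Real.log_inv, neg_mul, mul_comm (1 / 2 : ℝ)]

end Diagonalizes

/-- Squared modulus of the `j`-th component of `u` in the basis given by `V`. -/
def compSq (V : Matrix (Fin n) (Fin n) ℂ) (j : Fin n) (u : Coord n) : ℝ :=
  Complex.normSq (∑ μ, V μ j * (u μ : ℂ))

/-- Because u is real, the conjugate of ∑ V_μj u^μ is ∑ conj(V_μj) u^μ, and the bilinear form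
becomes a sum of squared moduli. -/
theorem quadratic_conjDiag (V : Matrix (Fin n) (Fin n) ℂ) (d : Fin n → ℝ) (u : Coord n) :
    ∑ μ, ∑ ν, (u μ : ℂ) * conjDiag V d μ ν * (u ν : ℂ) = ((∑ j, d j * compSq V j u : ℝ) : ℂ) := by
  have h1 : ∀ μ ν, conjDiag V d μ ν = ∑ j, V μ j * d j * (starRingEnd ℂ) (V ν j) := by
    intro μ ν
    rw [conjDiag, Matrix.mul_apply]
    simp only [Matrix.mul_diagonal, Matrix.conjTranspose_apply, Complex.star_def]
  have h2 : ∀ j, ((compSq V j u : ℝ) : ℂ) =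
      ∑ μ, ∑ ν, (u μ : ℂ) * (V μ j * (starRingEnd ℂ) (V ν j)) * (u ν : ℂ) := by
    intro j
    rw [compSq, ← Complex.mul_conj, map_sum, Finset.sum_mul_sum]
    refine Finset.sum_congr rfl fun μ _ => Finset.sum_congr rfl fun ν _ => ?_
    rw [map_mul, Complex.conj_ofReal]
    ring
  push_cast
  simp only [h1, h2, Finset.mul_sum, Finset.sum_mul]
  rw [Finset.sum_comm]
  refine (Finset.sum_congr rfl fun μ _ => Finset.sum_comm).trans ?_
  rw [Finset.sum_comm]
  refine Finset.sum_congr rfl fun j _ => ?_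
  rw [Finset.sum_comm]
  refine Finset.sum_congr rfl fun μ _ => Finset.sum_congr rfl fun ν _ => ?_
  ring

theorem compSq_nonneg (V : Matrix (Fin n) (Fin n) ℂ) (j : Fin n) (u : Coord n) :
    0 ≤ compSq V j u := Complex.normSq_nonneg _

theorem compSq_smul (V : Matrix (Fin n) (Fin n) ℂ) (j : Fin n) (r : ℝ) (u : Coord n) :
    compSq V j (r • u) = r ^ 2 * compSq V j u := by
  have : ∑ μ, V μ j * ((r • u) μ : ℂ) = r * ∑ μ, V μ j * (u μ : ℂ) := by
    rw [Finset.mul_sum]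
    refine Finset.sum_congr rfl fun μ _ => ?_
    rw [PiLp.smul_apply, smul_eq_mul]
    push_cast
    ring
  rw [compSq, compSq, this, map_mul, Complex.normSq_ofReal, pow_two]

namespace Diagonalizes

variable {F : Matrix (Fin n) (Fin n) ℝ} {V : Matrix (Fin n) (Fin n) ℂ} {l : Fin n → ℝ}


theorem sum_compSq (h : Diagonalizes F V l) (u : Coord n) : ∑ j, compSq V j u = ‖u‖ ^ 2 := by
  have h1 := quadratic_conjDiag V (fun _ => 1) u
  rw [h.conjDiag_one] at h1
  simp only [Matrix.one_apply, mul_ite, ite_mul, mul_one, mul_zero, zero_mul, Finset.sum_ite_eq,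
    Finset.mem_univ, if_true, one_mul] at h1
  rw [EuclideanSpace.norm_sq_eq]
  simp only [Real.norm_eq_abs, sq_abs]
  apply Complex.ofReal_injective
  rw [← h1]
  push_cast
  simp only [pow_two]

/-- The kernel `U₀` as a real exponential. -/
theorem U0_eq (h : Diagonalizes F V l) {t : ℝ} (ht : 0 < t) (u : Coord n) : U0 F t u = ((Real.exp
    (∑ j, (-(1 / 2) * Real.log (4 * Real.pi * (t * sinhc (t * l j)))
      - (1 / 4) * (cothFun (l j) t * compSq V j u))) : ℝ) : ℂ) := by
  have hp := Real.pi_pos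
  rw [U0, h.J_eq, h.M_eq, quadratic_conjDiag, Real.rpow_def_of_pos (by positivity)]
  rw [show (-(1 / 4) : ℂ) = ((-(1 / 4) : ℝ) : ℂ) by push_cast; rfl, ← Complex.ofReal_mul,
    ← Complex.ofReal_mul, ← Complex.ofReal_exp, ← Complex.ofReal_mul, ← Real.exp_add,
    ← Real.exp_add]
  congr 2
  -- The prefactor (4πt)^(-n/2) is n equal factors, one for each eigenvalue.
  have h1 : ∀ j, Real.log (4 * Real.pi * (t * sinhc (t * l j))) =
      Real.log (4 * Real.pi * t) + Real.log (sinhc (t * l j)) := fun j => by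
    rw [← mul_assoc, Real.log_mul (by positivity) (sinhc_pos _).ne']
  simp only [h1, mul_add, Finset.sum_sub_distrib, Finset.sum_add_distrib, Finset.sum_const,
    Finset.card_univ, Fintype.card_fin, nsmul_eq_mul, Finset.mul_sum, neg_mul,
    Finset.sum_neg_distrib]
  ring

theorem U0_ne_zero (h : Diagonalizes F V l) {t : ℝ} (ht : 0 < t) (u : Coord n) : U0 F t u ≠ 0 := by
  rw [h.U0_eq ht]
  exact Complex.ofReal_ne_zero.2 (Real.exp_pos _).ne'

theorem hasDerivAt_U0 (h : Diagonalizes F V l) {t : ℝ} (ht : 0 < t) (u : Coord n) :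
    HasDerivAt (fun s => U0 F s u)
      (((∑ j, (-(1 / 2) * cothFun (l j) t
        + (1 / 4) * ((cothFun (l j) t ^ 2 - l j ^ 2) * compSq V j u)) : ℝ) : ℂ) * U0 F t u) t := by
  have h1 := (HasDerivAt.fun_sum (u := Finset.univ) fun j _ =>
    ((hasDerivAt_log_mul_sinhc (l j) ht).const_mul (-(1 / 2))).sub
      (((hasDerivAt_cothFun (l j) ht).mul_const (compSq V j u)).const_mul (1 / 4))).exp.ofReal_comp
  have h2 : (fun s => U0 F s u) =ᶠ[𝓝 t] fun s => ((Real.exp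
      (∑ j, (-(1 / 2) * Real.log (4 * Real.pi * (s * sinhc (s * l j)))
        - (1 / 4) * (cothFun (l j) s * compSq V j u))) : ℝ) : ℂ) := by
    -- The real form of U₀ holds for positive times, hence near `t`.
    filter_upwards [lt_mem_nhds ht] with s hs using h.U0_eq hs u
  refine (h1.congr_of_eventuallyEq h2).congr_deriv ?_
  rw [h.U0_eq ht, ← Complex.ofReal_mul, mul_comm]
  refine congrArg _ (congrArg₂ _ ?_ rfl)
  refine Finset.sum_congr rfl fun j _ => ?_
  ring

end Diagonalizes

end Diagonal

/-! ### The heat equation -/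

section Heat

variable {n : ℕ}

theorem pd_sum {A κ : Type*} [NormedAddCommGroup A] [NormedSpace ℝ A] (s : Finset κ)
    {f : κ → Coord n → A} {u : Coord n} (hf : ∀ k ∈ s, DifferentiableAt ℝ (f k) u) (i : Fin n) :
    pd i (fun v => ∑ k ∈ s, f k v) u = ∑ k ∈ s, pd i (f k) u := by
  simp only [pd]
  rw [fderiv_fun_sum hf, sum_apply]

theorem contDiff_coord (j : Fin n) : ContDiff ℝ ∞ fun v : Coord n => (v j : ℂ) :=
  Complex.ofRealCLM.contDiff.comp (show ContDiff ℝ ∞ fun v : Coord n => v j by fun_prop)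

theorem differentiable_coord (j : Fin n) : Differentiable ℝ fun v : Coord n => (v j : ℂ) :=
  (contDiff_coord j).differentiable (by simp)

theorem pd_complex_coord (i j : Fin n) (u : Coord n) :
    pd i (fun v : Coord n => (v j : ℂ)) u = if i = j then 1 else 0 := by
  have := pd_clm Complex.ofRealCLM (f := fun v : Coord n => v j) (u := u) (by fun_prop) i
  rw [pd_coord] at this
  refine this.trans ?_
  split_ifs <;> simp

theorem pd_mul {f g : Coord n → ℂ} {u : Coord n} (hf : DifferentiableAt ℝ f u)
    (hg : DifferentiableAt ℝ g u) (i : Fin n) :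
    pd i (fun v => f v * g v) u = f u * pd i g u + pd i f u * g u :=
  pd_smul hf hg i

theorem pd_const_mul (c : ℂ) {g : Coord n → ℂ} {u : Coord n} (hg : DifferentiableAt ℝ g u)
    (i : Fin n) : pd i (fun v => c * g v) u = c * pd i g u := by
  rw [pd_mul (differentiableAt_const c) hg, pd_const, zero_mul, add_zero]

theorem pd_cexp {f : Coord n → ℂ} {u : Coord n} (hf : DifferentiableAt ℝ f u) (i : Fin n) :
    pd i (fun v => Complex.exp (f v)) u = Complex.exp (f u) * pd i f u := by
  rw [pd, hf.hasFDerivAt.cexp.fderiv]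
  rfl

/-- The linear function `u ↦ -(1/2) A_{μν} u^ν`. -/
def rowFun (A : Matrix (Fin n) (Fin n) ℂ) (μ : Fin n) : Coord n →ₗ[ℝ] ℂ where
  toFun u := -(1 / 2) * ∑ ν, A μ ν * (u ν : ℂ)
  map_add' u v := by
    simp only [PiLp.add_apply, Complex.ofReal_add, mul_add, Finset.sum_add_distrib]
  map_smul' r u := by
    simp only [PiLp.smul_apply, smul_eq_mul, Complex.ofReal_mul, Finset.mul_sum,
      RingHom.id_apply, Complex.real_smul]
    exact Finset.sum_congr rfl fun ν _ => by ring

theorem rowFun_apply (A : Matrix (Fin n) (Fin n) ℂ) (μ : Fin n) (u : Coord n) :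
    rowFun A μ u = -(1 / 2) * ∑ ν, A μ ν * (u ν : ℂ) := rfl

theorem differentiable_rowFun (A : Matrix (Fin n) (Fin n) ℂ) (μ : Fin n) :
    Differentiable ℝ (rowFun A μ) :=
  (LinearMap.toContinuousLinearMap (rowFun A μ)).differentiable

theorem pd_rowFun (A : Matrix (Fin n) (Fin n) ℂ) (μ i : Fin n) (u : Coord n) :
    pd i (rowFun A μ) u = -(1 / 2) * A μ i := by
  have h1 : (rowFun A μ : Coord n → ℂ) = fun u => -(1 / 2) * ∑ ν, A μ ν * (u ν : ℂ) := rfl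
  have h2 : ∀ ν, DifferentiableAt ℝ (fun v : Coord n => A μ ν * (v ν : ℂ)) u := fun ν =>
    (differentiable_coord ν u).const_mul _
  rw [h1, pd_const_mul _ (DifferentiableAt.fun_sum fun ν _ => h2 ν), pd_sum _ fun ν _ => h2 ν]
  simp only [pd_const_mul _ (differentiable_coord _ u), pd_complex_coord, mul_ite, mul_one,
    mul_zero, Finset.sum_ite_eq, Finset.mem_univ, if_true]

theorem contDiff_quadratic (A : Matrix (Fin n) (Fin n) ℂ) :
    ContDiff ℝ ∞ fun u : Coord n => ∑ μ, ∑ ν, (u μ : ℂ) * A μ ν * (u ν : ℂ) :=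
  ContDiff.sum fun μ _ => ContDiff.sum fun ν _ =>
    ((contDiff_coord μ).mul contDiff_const).mul (contDiff_coord ν)

theorem pd_quadratic {A : Matrix (Fin n) (Fin n) ℂ} (hA : A.transpose = A) (i : Fin n)
    (u : Coord n) : pd i (fun u : Coord n => ∑ μ, ∑ ν, (u μ : ℂ) * A μ ν * (u ν : ℂ)) u
      = 2 * ∑ ν, A i ν * (u ν : ℂ) := by
  have h1 : (fun u : Coord n => ∑ μ, ∑ ν, (u μ : ℂ) * A μ ν * (u ν : ℂ)) =
      fun u => ∑ μ, -2 * ((u μ : ℂ) * rowFun A μ u) := by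
    funext u
    refine Finset.sum_congr rfl fun μ _ => ?_
    rw [rowFun_apply, Finset.mul_sum, Finset.mul_sum, Finset.mul_sum]
    exact Finset.sum_congr rfl fun ν _ => by ring
  have h2 : ∀ μ, DifferentiableAt ℝ (fun u : Coord n => (u μ : ℂ) * rowFun A μ u) u := fun μ =>
    (differentiable_coord μ u).mul (differentiable_rowFun A μ u)
  rw [h1, pd_sum _ fun μ _ => (h2 μ).const_mul _]
  simp only [pd_const_mul _ (h2 _),
    pd_mul (differentiable_coord _ u) (differentiable_rowFun A _ u), pd_rowFun, pd_complex_coord,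
    mul_add, Finset.sum_add_distrib, ite_mul, one_mul, zero_mul, mul_ite, mul_zero,
    Finset.sum_ite_eq, Finset.mem_univ, if_true]
  rw [rowFun_apply]
  have h3 : ∀ μ, A μ i = A i μ := fun μ => congrFun (congrFun hA i) μ
  simp only [h3]
  rw [two_mul, Finset.mul_sum, Finset.mul_sum]
  congr 1
  · exact Finset.sum_congr rfl fun ν _ => by ring
  · exact Finset.sum_congr rfl fun ν _ => by ring

theorem contDiff_U0 (F : Matrix (Fin n) (Fin n) ℝ) (t : ℝ) : ContDiff ℝ ∞ (U0 F t) :=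
  contDiff_const.mul (contDiff_const.mul (contDiff_quadratic _)).cexp

/-- The matrix `iF`. -/
def iF (F : Matrix (Fin n) (Fin n) ℝ) : Matrix (Fin n) (Fin n) ℂ :=
  Complex.I • F.map (fun x : ℝ => (x : ℂ))

/-- The gradient of the exponent contributes -½ M u, the potential -½ iF u. -/
theorem covD_U0 {F : Matrix (Fin n) (Fin n) ℝ} {t : ℝ} (hM : (M F t).transpose = M F t)
    (μ : Fin n) (u : Coord n) :
    covD F μ (U0 F t) u = rowFun (M F t + iF F) μ u * U0 F t u := by
  have hq := (contDiff_quadratic (M F t)).differentiable (by simp) u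
  have h1 : pd μ (U0 F t) u = rowFun (M F t) μ u * U0 F t u := by
    unfold U0
    rw [pd_const_mul _ (hq.const_mul _).cexp, pd_cexp (hq.const_mul _), pd_const_mul _ hq,
      pd_quadratic hM, rowFun_apply]
    ring
  rw [covD, h1, smul_eq_mul, ← sub_mul, rowFun_apply, rowFun_apply]
  congr 1
  simp only [Matrix.add_apply, add_mul, Finset.sum_add_distrib, iF, Matrix.smul_apply,
    Matrix.map_apply, smul_eq_mul, Finset.mul_sum, mul_add]
  rw [sub_eq_add_neg, ← Finset.sum_neg_distrib]
  congr 1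
  exact Finset.sum_congr rfl fun ν _ => by ring

theorem isGaussian_U0 {F : Matrix (Fin n) (Fin n) ℝ} {t : ℝ} (hM : (M F t).transpose = M F t) :
    IsGaussian F (U0 F t) :=
  ⟨contDiff_U0 F t, fun μ => ⟨rowFun (M F t + iF F) μ, fun u => covD_U0 hM μ u⟩⟩

/-- The second 𝓓_μ either differentiates the linear factor, giving the trace, or acts on U₀ once
more, giving the square. -/
theorem covDsq_U0 {F : Matrix (Fin n) (Fin n) ℝ} {t : ℝ} (hM : (M F t).transpose = M F t)
    (u : Coord n) : covDsq F (U0 F t) u =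
      (-(1 / 2) * (M F t + iF F).trace + ∑ μ, rowFun (M F t + iF F) μ u ^ 2) * U0 F t u := by
  rw [covDsq, Matrix.trace, Finset.mul_sum, ← Finset.sum_add_distrib, Finset.sum_mul]
  refine Finset.sum_congr rfl fun μ _ => ?_
  have h1 := covD_U0 hM μ u
  rw [covD, smul_eq_mul, sub_eq_iff_eq_add] at h1
  rw [show covD F μ (U0 F t) = fun u => rowFun (M F t + iF F) μ u * U0 F t u from
    funext fun u => covD_U0 hM μ u, covD,
    pd_mul (differentiable_rowFun _ μ u) ((contDiff_U0 F t).differentiable (by simp) u), h1,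
    pd_rowFun, smul_eq_mul, Matrix.diag_apply]
  ring

theorem iF_transpose {F : Matrix (Fin n) (Fin n) ℝ} (hF : F.transpose = -F) :
    (iF F).transpose = -iF F := by
  ext i j
  have : F j i = -F i j := congrFun (congrFun hF i) j
  simp [iF, this]

theorem tiF_transpose {F : Matrix (Fin n) (Fin n) ℝ} (hF : F.transpose = -F) (t : ℝ) :
    (tiF F t).transpose = -tiF F t := by
  rw [show tiF F t = (t : ℂ) • iF F from mul_smul _ _ _, Matrix.transpose_smul, iF_transpose hF,
    smul_neg]

/-- Only even powers occur, and these are symmetric when T is antisymmetric. -/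
theorem matCosh_transpose {T : Matrix (Fin n) (Fin n) ℂ} (hT : T.transpose = -T) :
    (matCosh T).transpose = matCosh T := by
  rw [matCosh, Matrix.transpose_tsum]
  simp only [Matrix.transpose_smul, Matrix.transpose_pow, hT, (even_two_mul _).neg_pow]

theorem matSinhc_transpose {T : Matrix (Fin n) (Fin n) ℂ} (hT : T.transpose = -T) :
    (matSinhc T).transpose = matSinhc T := by
  rw [matSinhc, Matrix.transpose_tsum]
  simp only [Matrix.transpose_smul, Matrix.transpose_pow, hT, (even_two_mul _).neg_pow]

theorem conjDiag_add (V : Matrix (Fin n) (Fin n) ℂ) (d d' : Fin n → ℝ) :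
    conjDiag V d + conjDiag V d' = conjDiag V fun j => d j + d' j := by
  simp only [conjDiag, ← Matrix.mul_add, ← Matrix.add_mul, Matrix.diagonal_add, Complex.ofReal_add]

theorem conjDiag_neg (V : Matrix (Fin n) (Fin n) ℂ) (d : Fin n → ℝ) :
    conjDiag V (fun j => -d j) = -conjDiag V d := by
  have := conjDiag_smul V (-1) d
  simpa using this.symm

namespace Diagonalizes

variable {F : Matrix (Fin n) (Fin n) ℝ} {V : Matrix (Fin n) (Fin n) ℂ} {l : Fin n → ℝ}

/-- Both factors are even in F, hence symmetric, and they commute. The diagonal form does not show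
this, as V is merely unitary. -/
theorem M_transpose (h : Diagonalizes F V l) (hF : F.transpose = -F) (t : ℝ) :
    (M F t).transpose = M F t := by
  rw [M, Matrix.transpose_smul, Matrix.transpose_mul, Matrix.transpose_nonsing_inv,
    matCosh_transpose (tiF_transpose hF t), matSinhc_transpose (tiF_transpose hF t), h.matCosh_eq,
    h.matSinhc_eq, h.conjDiag_inv fun j => (sinhc_pos _).ne', h.conjDiag_mul, h.conjDiag_mul]
  simp only [mul_comm]

/-- Transposition turns M + iF into M - iF, and the two commute, so the sum of squares has the
matrix ¼(M² - (iF)²); the trace of iF vanishes. The result is the time derivative in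
`hasDerivAt_U0`. -/
theorem covDsq_U0 (h : Diagonalizes F V l) (hF : F.transpose = -F) (t : ℝ) (u : Coord n) :
    covDsq F (U0 F t) u = ((∑ j, (-(1 / 2) * cothFun (l j) t
        + (1 / 4) * ((cothFun (l j) t ^ 2 - l j ^ 2) * compSq V j u)) : ℝ) : ℂ) * U0 F t u := by
  have hM := h.M_transpose hF t
  have hi : iF F = conjDiag V l := h.eq
  rw [HeatCoeff.covDsq_U0 hM]
  congr 1
  have htr : (iF F).trace = 0 := by
    have h1 := Matrix.trace_transpose (iF F)
    rw [iF_transpose hF, Matrix.trace_neg] at h1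
    exact self_eq_neg.1 h1.symm
  have hsq : ∑ μ, rowFun (M F t + iF F) μ u ^ 2 = (1 / 4) * ∑ α, ∑ β, (u α : ℂ) *
      ((M F t + iF F).transpose * (M F t + iF F)) α β * (u β : ℂ) := by
    simp only [rowFun_apply, Matrix.mul_apply, Matrix.transpose_apply, pow_two
      (∑ ν, _), Finset.mul_sum, Finset.sum_mul]
    rw [Finset.sum_comm]
    refine Finset.sum_congr rfl fun α _ => ?_
    rw [Finset.sum_comm]
    refine Finset.sum_congr rfl fun β _ => Finset.sum_congr rfl fun μ _ => ?_
    ring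
  have hprod : (M F t + iF F).transpose * (M F t + iF F) =
      conjDiag V fun j => cothFun (l j) t ^ 2 - l j ^ 2 := by
    rw [Matrix.transpose_add, hM, iF_transpose hF, h.M_eq, hi, ← conjDiag_neg, conjDiag_add,
      conjDiag_add, h.conjDiag_mul]
    congr 1
    funext j
    ring
  rw [Matrix.trace_add, htr, add_zero, hsq, hprod, quadratic_conjDiag, h.M_eq, h.trace_conjDiag,
    Finset.sum_add_distrib, ← Finset.mul_sum, ← Finset.mul_sum]
  push_cast
  ring

/-- The kernel `U₀` solves the heat equation of `𝓓²`. -/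
theorem heat_equation (h : Diagonalizes F V l) (hF : F.transpose = -F) {t : ℝ} (ht : 0 < t)
    (u : Coord n) : HasDerivAt (fun s => U0 F s u) (covDsq F (U0 F t) u) t := by
  rw [h.covDsq_U0 hF]
  exact h.hasDerivAt_U0 ht u

end Diagonalizes

end Heat

/-! ### The initial condition -/

section Initial

variable {n : ℕ}

theorem integral_exp_neg_norm_sq :
    ∫ v : Coord n, Real.exp (-(1 / 4) * ‖v‖ ^ 2) =
      Real.exp (n * (1 / 2 * Real.log (4 * Real.pi))) := by
  have hp := Real.pi_pos
  rw [GaussianFourier.integral_rexp_neg_mul_sq_norm (by norm_num), finrank_euclideanSpace_fin,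
    Real.rpow_def_of_pos (by positivity), show Real.pi / (1 / 4) = 4 * Real.pi by ring]
  congr 1
  ring

theorem integrable_exp_neg_norm_sq :
    Integrable fun v : Coord n => Real.exp (-(1 / 4) * ‖v‖ ^ 2) := by
  -- A non-integrable function would have integral 0 by convention.
  refine Integrable.of_integral_ne_zero ?_
  rw [integral_exp_neg_norm_sq]
  exact (Real.exp_pos _).ne'

/-- The Jacobian t^(n/2) is written as an exponential so that it merges with the exponent of U₀. -/
theorem integral_scale (g : Coord n → ℂ) {t : ℝ} (ht : 0 < t) :
    ∫ u, g u = ∫ v : Coord n, ((Real.exp (∑ _j : Fin n, 1 / 2 * Real.log t) : ℝ) : ℂ) *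
      g (Real.sqrt t • v) := by
  have hs := Real.sqrt_pos.2 ht
  rw [integral_const_mul, Measure.integral_comp_smul_of_nonneg (μ := volume) (hR := hs.le),
    finrank_euclideanSpace_fin]
  have h1 : Real.exp (∑ _j : Fin n, 1 / 2 * Real.log t) = Real.sqrt t ^ n := by
    rw [Finset.sum_const, Finset.card_univ, Fintype.card_fin, nsmul_eq_mul, Real.exp_nat_mul,
      Real.sqrt_eq_rpow, Real.rpow_def_of_pos ht, mul_comm (1 / 2 : ℝ)]
  rw [h1, ← Complex.coe_smul, smul_eq_mul, ← mul_assoc, ← Complex.ofReal_mul,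
    mul_inv_cancel₀ (pow_pos hs n).ne', Complex.ofReal_one, one_mul]

namespace Diagonalizes

variable {F : Matrix (Fin n) (Fin n) ℝ} {V : Matrix (Fin n) (Fin n) ℂ} {l : Fin n → ℝ}

/-- At u = √t v the Jacobian cancels t^(-n/2) and the factor t of |u|² cancels the pole of l
coth(tl), so nothing singular is left at t = 0. -/
theorem U0_scale (h : Diagonalizes F V l) {t : ℝ} (ht : 0 < t) (v : Coord n) :
    ((Real.exp (∑ _j : Fin n, 1 / 2 * Real.log t) : ℝ) : ℂ) * U0 F t (Real.sqrt t • v) =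
      ((Real.exp (∑ j, (-(1 / 2) * Real.log (4 * Real.pi * sinhc (t * l j))
        - (1 / 4) * (Real.cosh (t * l j) / sinhc (t * l j) * compSq V j v))) : ℝ) : ℂ) := by
  have hp := Real.pi_pos
  rw [h.U0_eq ht, ← Complex.ofReal_mul, ← Real.exp_add, ← Finset.sum_add_distrib]
  congr 3
  funext j
  have hs := sinhc_pos (t * l j)
  rw [compSq_smul, Real.sq_sqrt ht.le, cothFun,
    show 4 * Real.pi * (t * sinhc (t * l j)) = t * (4 * Real.pi * sinhc (t * l j)) by ring,
    Real.log_mul ht.ne' (by positivity)]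
  field_simp
  ring

/-- The kernel `U₀` tends to the Dirac distribution as `t → 0⁺`. -/
theorem tendsto_integral_U0 (h : Diagonalizes F V l) {f : Coord n → ℂ} (hf : Continuous f)
    (hc : HasCompactSupport f) :
    Tendsto (fun t : ℝ => ∫ u, U0 F t u * f u) (𝓝[>] 0) (𝓝 (f 0)) := by
  have hp := Real.pi_pos
  obtain ⟨C, hC⟩ := hc.exists_bound_of_continuous hf
  -- K = (4π)^(-n/2) normalizes the limiting Gaussian.
  let K : ℝ := Real.exp (n * (-(1 / 2) * Real.log (4 * Real.pi)))
  have hlim : ∫ v : Coord n, ((K * Real.exp (-(1 / 4) * ‖v‖ ^ 2) : ℝ) : ℂ) * f 0 = f 0 := by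
    rw [integral_mul_const, integral_complex_ofReal, integral_const_mul, integral_exp_neg_norm_sq,
      ← Real.exp_add, ← mul_add]
    simp
  rw [← hlim]
  have hexp : ∀ v : Coord n, K * Real.exp (-(1 / 4) * ‖v‖ ^ 2) =
      Real.exp (∑ j, (-(1 / 2) * Real.log (4 * Real.pi) - (1 / 4) * compSq V j v)) := by
    intro v
    rw [← Real.exp_add, Finset.sum_sub_distrib, ← Finset.mul_sum Finset.univ (compSq V · v),
      h.sum_compSq, Finset.sum_const,
      Finset.card_univ, Fintype.card_fin, nsmul_eq_mul]
    congr 1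
    ring
  have hev : (fun t : ℝ => ∫ v : Coord n,
      ((Real.exp (∑ j, (-(1 / 2) * Real.log (4 * Real.pi * sinhc (t * l j))
        - (1 / 4) * (Real.cosh (t * l j) / sinhc (t * l j) * compSq V j v))) : ℝ) : ℂ)
        * f (Real.sqrt t • v)) =ᶠ[𝓝[>] 0] fun t => ∫ u, U0 F t u * f u := by
    filter_upwards [self_mem_nhdsWithin] with t ht
    rw [integral_scale (fun u => U0 F t u * f u) ht]
    refine integral_congr_ae (Eventually.of_forall fun v => ?_)
    beta_reduce
    rw [← mul_assoc, h.U0_scale ht]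
  refine Tendsto.congr' hev ?_
  refine tendsto_integral_filter_of_dominated_convergence
    (fun v => K * Real.exp (-(1 / 4) * ‖v‖ ^ 2) * C) ?_ ?_
    ((integrable_exp_neg_norm_sq.const_mul K).mul_const C) ?_
  · refine Eventually.of_forall fun t => Continuous.aestronglyMeasurable ?_
    have hcomp : ∀ j, Continuous fun v : Coord n => compSq V j v := fun j =>
      Complex.continuous_normSq.comp (continuous_finsetSum _ fun μ _ =>
        continuous_const.mul (contDiff_coord μ).continuous)
    refine Continuous.mul (Complex.continuous_ofReal.comp (Real.continuous_exp.comp ?_))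
      (hf.comp (continuous_const_smul _))
    exact continuous_finsetSum _ fun j _ =>
      continuous_const.sub (continuous_const.mul (continuous_const.mul (hcomp j)))
  -- Since 1 ≤ sinhc ≤ cosh, replacing sinhc and cosh/sinhc by 1 only increases the exponent; the
  -- bound is uniform in t.
  · refine Eventually.of_forall fun t => Eventually.of_forall fun v => ?_
    rw [norm_mul, hexp, Complex.norm_real, Real.norm_eq_abs, Real.abs_exp]
    refine mul_le_mul (Real.exp_le_exp.2 (Finset.sum_le_sum fun j _ => ?_)) (hC _)
      (norm_nonneg _) (Real.exp_pos _).le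
    have hs := sinhc_pos (t * l j)
    have h1 : Real.log (4 * Real.pi) ≤ Real.log (4 * Real.pi * sinhc (t * l j)) :=
      Real.log_le_log (by positivity) (le_mul_of_one_le_right (by positivity) (one_le_sinhc _))
    have h2 : compSq V j v ≤ Real.cosh (t * l j) / sinhc (t * l j) * compSq V j v :=
      le_mul_of_one_le_left (compSq_nonneg V j v) ((one_le_div hs).2 (sinhc_le_cosh _))
    linarith
  · refine Eventually.of_forall fun v => ?_
    rw [hexp]
    refine Tendsto.mul ((Complex.continuous_ofReal.tendsto _).comp
      ((Real.continuous_exp.tendsto _).comp (tendsto_finsetSum _ fun j _ => ?_))) ?_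
    · have hs := tendsto_sinhc (l j)
      have hcosh : Tendsto (fun t => Real.cosh (t * l j)) (𝓝[>] 0) (𝓝 1) := by
        have : Continuous fun t => Real.cosh (t * l j) := by fun_prop
        simpa using (this.tendsto 0).mono_left nhdsWithin_le_nhds
      have h1 := ((hs.const_mul (4 * Real.pi)).log (by positivity)).const_mul (-(1 / 2))
      have h2 := (((hcosh.div hs one_ne_zero).mul_const (compSq V j v)).const_mul (1 / 4))
      simpa using h1.sub h2
    · have h1 : Tendsto (fun t : ℝ => f (Real.sqrt t • v)) (𝓝 0) (𝓝 (f (Real.sqrt 0 • v))) :=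
        (hf.comp (Real.continuous_sqrt.smul continuous_const)).tendsto 0
      rw [Real.sqrt_zero, zero_smul] at h1
      exact h1.mono_left nhdsWithin_le_nhds

end Diagonalizes

end Initial

/-! ### Antisymmetry of the curvature, and the theorem. -/

theorem LocalData.curvF_swap {n N : ℕ} (D : LocalData n N) (a b : Fin n) (y : Coord n) :
    D.curvF b a y = -D.curvF a b y := by
  rw [curvF, curvF, neg_sub]

theorem NormalData.F_transpose {n N : ℕ} (D : NormalData n N) : D.F.transpose = -D.F := by
  ext μ ν
  rw [Matrix.transpose_apply, Matrix.neg_apply, F, F, Finset.sum_comm, ← Finset.sum_neg_distrib]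
  refine Finset.sum_congr rfl fun a _ => ?_
  rw [← Finset.sum_neg_distrib]
  refine Finset.sum_congr rfl fun b _ => ?_
  rw [D.curvF_swap a b]
  ring

end HeatCoeff

end

theorem mainTheorem4 {n N : ℕ}
    -- a Riemannian manifold without boundary
    {X : Type*} [TopologicalSpace X] [ChartedSpace (HeatCoeff.Coord n) X]
    [IsManifold (𝓡 n) ∞ X] [RiemannianBundle (fun x : X => TangentSpace (𝓡 n) x)]
    [IsContMDiffRiemannianBundle (𝓡 n) ∞ (HeatCoeff.Coord n)
      (fun x : X => TangentSpace (𝓡 n) x)]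
    -- a smooth complex vector bundle
    {S : X → Type*} [TopologicalSpace (TotalSpace (HeatCoeff.Fib N) S)]
    [∀ x, AddCommGroup (S x)] [∀ x, Module ℂ (S x)] [∀ x, TopologicalSpace (S x)]
    [∀ x, IsTopologicalAddGroup (S x)] [∀ x, ContinuousSMul ℝ (S x)]
    [FiberBundle (HeatCoeff.Fib N) S] [VectorBundle ℂ (HeatCoeff.Fib N) S]
    [VectorBundle ℝ (HeatCoeff.Fib N) S]
    [ContMDiffVectorBundle ∞ (HeatCoeff.Fib N) S (𝓡 n)]
    -- a smooth complex linear connection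
    (cov : CovariantDerivative (𝓡 n) (HeatCoeff.Fib N) S)
    [CovariantDerivative.ContMDiffCovariantDerivative cov ∞]
    (hcov : ∀ (σ : Π x : X, S x) (x : X),
      MDifferentiableAt (𝓡 n) ((𝓡 n).prod 𝓘(ℝ, HeatCoeff.Fib N))
        (fun y => TotalSpace.mk' (HeatCoeff.Fib N) y (σ y)) x →
      ∀ v, cov (fun y => Complex.I • σ y) x v = Complex.I • cov σ x v)
    -- the base point, a chart and a trivialization around it
    (x₀ : X) (φ : OpenPartialHomeomorph X (HeatCoeff.Coord n))
    (hφ : φ ∈ IsManifold.maximalAtlas (𝓡 n) ∞ X) (hx₀ : x₀ ∈ φ.source)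
    (e : Trivialization (HeatCoeff.Fib N)
      (TotalSpace.proj : TotalSpace (HeatCoeff.Fib N) S → X))
    [MemTrivializationAtlas e] (he : x₀ ∈ e.baseSet)
    -- the potential of the U(1) part of the connection, with parallel curvature
    (pot : Fin n → HeatCoeff.Coord n → ℝ)
    (hpot : ∀ a, ContDiffOn ℝ ∞ (pot a) φ.target)
    (hF : (HeatCoeff.localData φ e cov pot).ParallelF φ.target)
    -- normal coordinates and parallel transports on a geodesic ball
    (r : ℝ) (hr : 0 < r) (ψ : HeatCoeff.Coord n → HeatCoeff.Coord n)
    (hψ : (HeatCoeff.localData φ e cov pot).IsNormalCoord (φ x₀) r ψ)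
    (hψr : ∀ u ∈ Metric.ball (0 : HeatCoeff.Coord n) r,
      ψ u ∈ φ.target ∧ φ.symm (ψ u) ∈ e.baseSet)
    (P : HeatCoeff.Coord n → HeatCoeff.EndF N)
    (hP : (HeatCoeff.localData φ e cov pot).IsTransportG ψ r P)
    (p : HeatCoeff.Coord n → ℂ)
    (hp : (HeatCoeff.localData φ e cov pot).IsTransportU ψ r p)
    (D : HeatCoeff.NormalData n N)
    (hD : D = { HeatCoeff.localData φ e cov pot with ψ := ψ, P := P, p := p }) :
    -- `U₀` is the fundamental solution of `∂_t - 𝓓²`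
    ((∀ t : ℝ, 0 < t → ∀ u, HasDerivAt (fun s => HeatCoeff.U0 D.F s u)
        (HeatCoeff.covDsq D.F (HeatCoeff.U0 D.F t) u) t) ∧
      ∀ f : HeatCoeff.Coord n → ℂ, Continuous f → HasCompactSupport f →
        Tendsto (fun t : ℝ => ∫ u, HeatCoeff.U0 D.F t u * f u) (𝓝[>] 0) (𝓝 (f 0))) ∧
    -- the series and integrals that define `V_k` and `T_k` converge
    (∀ (k : ℕ) (s : ℝ) (f : HeatCoeff.Coord n → HeatCoeff.EndF N), ContDiff ℝ ∞ f → ∀ u,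
      Summable (HeatCoeff.conjTerm D.F (D.Lk k) s f u)) ∧
    (∀ (j : ℕ) (js : List ℕ) (t : ℝ) (f : HeatCoeff.Coord n → HeatCoeff.EndF N),
      ContDiff ℝ ∞ f → ∀ u,
      IntervalIntegrable (fun s => HeatCoeff.volterra D.Vk js s (D.Vk j s f) u) volume 0 t) ∧
    -- the coefficients of odd order are odd polynomials and vanish on the diagonal
    ∀ (k : ℕ) (t : ℝ), 0 < t →
      HeatCoeff.IsOddPolynomial (D.b (2 * k + 1) t) ∧
      (∀ u, D.b (2 * k + 1) t (-u) = -D.b (2 * k + 1) t u) ∧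
      D.b (2 * k + 1) t 0 = 0 := by
  obtain ⟨V, l, h⟩ := HeatCoeff.exists_diagonalizes D.F_transpose
  refine ⟨⟨fun t ht u => h.heat_equation D.F_transpose ht u,
    fun f hf hc => h.tendsto_integral_U0 hf hc⟩,
    fun k s f hf u => D.summable_conjTerm k s (.mk f hf) u,
    fun j js t f hf u => D.intervalIntegrable_volterra j js t (.mk f hf) u, fun k t ht => ?_⟩
  have hb := D.gradedPoly_b (2 * k + 1) t
    (HeatCoeff.isGaussian_U0 (h.M_transpose D.F_transpose t)) (h.U0_ne_zero ht)
  -- The order 2k + 1 is 1 in `ZMod 2`, the odd class.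
  rw [ZMod.natCast_eq_one_iff_odd.2 (odd_two_mul_add_one k)] at hb
  have hodd : HeatCoeff.IsOddPolynomial (D.b (2 * k + 1) t) := hb.isOddPolynomial
  exact ⟨hodd, hodd.neg_apply, hodd.apply_zero⟩
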